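/- **Conventions.** Let $\mathfrak B=\{\bot,Y,N\}$ with the flat order ($u\le v$ iff $u=\bot$ or $u=v$) and the commutative product $x\bullet Y=x$, $x\bullet N=N$, $\bot\bullet\bot=\bot$. A *space of states* is a poset with a bottom element $\bot$ in which every non-empty family has an infimum. An *effect* of a poset $P$ is a symbol $\mathfrak l_{(\sigma,\sigma')}$ where $\sigma,\sigma'\in P$ have no common upper bound, or where one or both of them is the symbol $\cdot$ (which is below no element of $P$). It is evaluated by $\epsilon_{\mathfrak l_{(\sigma,\sigma')}}(\tau)=Y$ if $\sigma\le\tau$, $N$ if $\sigma'\le\tau$, and $\bot$ otherwise. A *real structure* $(\bar P,\star)$ on a space of states $P$ is a subset $\bar P\subseteq P$ (the *real states*) that contains $\bot$, is closed under infima of non-empty families, and in which every element is the infimum of the maximal elements of $\bar P$ (the *pure* states) above it, together with a map $\star$ on $\bar P\setminus\{\bot\}$ which is an order-reversing involution such that $\sigma,\sigma^\star$ never have a common upper bound in $P$, and such that the *real effects* separate the points of $P$. The real effects are $\mathfrak l_{(\sigma,\sigma')}$ with $\sigma,\sigma'\in\bar P\setminus\{\bot\}$, $\sigma'\ge\sigma^\star$,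 and $\mathfrak l_{(\sigma,\cdot)}$, $\mathfrak l_{(\cdot,\sigma)}$ ($\sigma\in\bar P$), $\mathfrak l_{(\cdot,\cdot)}$. Say that $(\mathfrak S',\star)$ satisfies the *basic conditions* if $\mathfrak S'$ is a space of states, every element of $\mathfrak S'$ is the infimum of the maximal elements above it, and $\star$ is an order-reversing involution of $\mathfrak S'\setminus\{\bot\}$ such that $\sigma,\sigma^\star$ never have a common upper bound. **Ontic completion.** Let $(\mathfrak S',\star)$ satisfy the basic conditions. For $U,V\subseteq\mathfrak S'$ write $U\sqsubseteq V$ if every element of $U$ is below some element of $V$. Put $\mathfrak c(U)=\mathrm{Max}\{\bigsqcup V\mid V\sqsubseteq U,\ V \text{ bounded above with a supremum}\}$ and $cl_{\mathfrak c}(U)=\mathrm{Max}\bigcup_{n\ge1}\mathfrak c^n(U)$. Let $K$ be the set of all $U\subseteq\mathfrak S'\setminus\{\bot\}$ such that $\sigma^\star\not\le\sigma'$ for all $\sigma,\sigma'\in U$, and let $Q_{\mathfrak c}=\{U\subseteq\mathfrak S'\setminus\{\bot\}\mid cl_{\mathfrak c}(U)\in K\}\cup\{\{\bot\}\}$. The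 ontic completion of $(\mathfrak S',\star)$ is $cl_{\mathfrak c}(Q_{\mathfrak c})$, ordered by $\sqsubseteq$. Its *canonical real structure*, when it exists, has as real states exactly the singletons $\{\sigma\}$, $\sigma\in\mathfrak S'$ (identified with $\sigma$), with $\{\sigma\}^\star=\{\sigma^\star\}$. **Minimal tensor product.** Let $(\bar{\mathfrak S}_A,\star)$, $(\bar{\mathfrak S}_B,\star)$ be real structures on $\mathfrak S_A,\mathfrak S_B$. Their minimal tensor product $\bar{\mathfrak S}_A\widetilde\otimes\bar{\mathfrak S}_B$ is the quotient of the set of all non-empty families $\{(\sigma_i,\tau_i)\}_i$ in $\bar{\mathfrak S}_A\times\bar{\mathfrak S}_B$ which identifies two families when $\bigwedge_i\epsilon_{\mathfrak l_A}(\sigma_i)\bullet\epsilon_{\mathfrak l_B}(\tau_i)$ is the same for all real effects $\mathfrak l_A,\mathfrak l_B$. It is ordered by pointwise comparison of these values. The class of $\{(\sigma,\tau)\}$ is $\sigma\otimes\tau$. For a non-bottom element $\sigma$, define $\sigma^\star=\bigsqcup\{\alpha^\star\otimes\bot\sqcap\bot\otimes\beta^\star\mid \alpha,\beta \text{ pure},\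 \sigma\le\alpha\otimes\beta\}$. **Theorem.** Let $(\bar{\mathfrak S}_A,\star)$ and $(\bar{\mathfrak S}_B,\star)$ satisfy the basic conditions and the ascending chain condition (no infinite strictly increasing sequence), and let each have more than one element. Let $\mathfrak S_A,\mathfrak S_B$ be their ontic completions. Then: 1. $\mathfrak S_A$ and $\mathfrak S_B$ are spaces of states and carry their canonical real structures $(\bar{\mathfrak S}_A,\star)$, $(\bar{\mathfrak S}_B,\star)$. 2. The suprema that define $\star$ on $\bar{\mathfrak S}_A\widetilde\otimes\bar{\mathfrak S}_B$ exist, and $(\alpha\otimes\beta)^\star=\alpha^\star\otimes\bot\sqcap\bot\otimes\beta^\star$ for all pure $\alpha,\beta$. The pair $(\bar{\mathfrak S}_A\widetilde\otimes\bar{\mathfrak S}_B,\star)$ satisfies the basic conditions. It also satisfies the finite rank condition: every subset $U$ that is bounded above has a supremum, which is also the supremum of some finite $V\sqsubseteq U$. 3. The ontic completion $\mathfrak S_A\widehat\otimes\mathfrak S_B$ of $(\bar{\mathfrak S}_A\widetilde\otimes\bar{\mathfrak S}_B,\star)$ is a space of states (it has a bottom element, and infima of all non-empty families), and it carries the canonical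 real structure $(\bar{\mathfrak S}_A\widetilde\otimes\bar{\mathfrak S}_B,\star)$. 4. In $\mathfrak S_A\widehat\otimes\mathfrak S_B$: - *(pure tensors)* $\sigma\otimes\tau$ is a real state for all $\sigma\in\bar{\mathfrak S}_A$, $\tau\in\bar{\mathfrak S}_B$, the bottom element is $\bot\otimes\bot$, and every real state is an infimum of a non-empty family of such $\sigma\otimes\tau$; - *(local tomography)* if $x=\bigwedge_i\sigma_i\otimes\tau_i$ and $y=\bigwedge_j\sigma'_j\otimes\tau'_j$ are real states (non-empty families) and $\bigwedge_i\epsilon_{\mathfrak l_A}(\sigma_i)\bullet\epsilon_{\mathfrak l_B}(\tau_i)=\bigwedge_j\epsilon_{\mathfrak l_A}(\sigma'_j)\bullet\epsilon_{\mathfrak l_B}(\tau'_j)$ for all real effects $\mathfrak l_A,\mathfrak l_B$, then $x=y$; - *(bimorphism)* $(\bigwedge_i\sigma_i)\otimes\tau=\bigwedge_i(\sigma_i\otimes\tau)$ and $\sigma\otimes(\bigwedge_i\tau_i)=\bigwedge_i(\sigma\otimes\tau_i)$ for all non-empty families of real states; - *(partial traces)* there are maps $\bar{\mathfrak S}_A\widetilde\otimes\bar{\mathfrak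 S}_B\to\bar{\mathfrak S}_A$ and $\bar{\mathfrak S}_A\widetilde\otimes\bar{\mathfrak S}_B\to\bar{\mathfrak S}_B$ which preserve infima of non-empty families and send $\bigwedge_i\sigma_i\otimes\tau_i$ to $\bigwedge_i\sigma_i$ and to $\bigwedge_i\tau_i$ respectively. -/

import Mathlib

open Set

/-! ### The boolean domain `{⊥, Y, N}` -/

/-- The boolean domain, whose elements are the possible determinations of a yes/no test. -/
inductive BDom : Type
  | bot : BDom
  | Y : BDom
  | N : BDom

namespace BDom

/-- The flat order: `u ≤ v` iff `u = ⊥` or `u = v`. -/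
instance : PartialOrder BDom where
  le u v := u = bot ∨ u = v
  le_refl _ := Or.inr rfl
  le_trans := by
    rintro a b c (rfl | rfl) h
    · exact Or.inl rfl
    · exact h
  le_antisymm := by
    rintro a b (rfl | rfl) (h | h)
    · exact h.symm
    · exact h.symm
    · rfl
    · rfl

/-- The commutative product: `x • Y = x`, `x • N = N`, `⊥ • ⊥ = ⊥`. -/
def mul : BDom → BDom → BDom
  | Y, x => x
  | N, _ => N
  | bot, N => N
  | bot, Y => bot
  | bot, bot => bot

open Classical in
/-- The infimum of a (non-empty) set of determinations. -/
noncomputable def meet (S : Set BDom) : BDom :=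
  if ∀ x ∈ S, x = Y then Y else if ∀ x ∈ S, x = N then N else bot

theorem isGLB_meet {S : Set BDom} (hS : S.Nonempty) : IsGLB S (meet S) := by
  obtain ⟨a, ha⟩ := hS
  unfold meet
  split_ifs with h1 h2
  · exact ⟨fun x hx => Or.inr (h1 x hx).symm, fun b hb => (h1 a ha) ▸ hb ha⟩
  · exact ⟨fun x hx => Or.inr (h2 x hx).symm, fun b hb => (h2 a ha) ▸ hb ha⟩
  · refine ⟨fun x _ => Or.inl rfl, fun b hb => ?_⟩
    push Not at h1 h2
    obtain ⟨x, hx, hxY⟩ := h1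
    obtain ⟨z, hz, hzN⟩ := h2
    rcases hb hx with h | h
    · exact Or.inl h
    · rcases hb hz with h' | h'
      · exact Or.inl h'
      · cases b with
        | bot => exact Or.inl rfl
        | Y => exact absurd h.symm hxY
        | N => exact absurd h'.symm hzN

end BDom

/-! ### Spaces of states, effects, real structures -/

/-- A space of states: a poset with a bottom element in which every non-empty family has an
infimum. -/
structure IsStateSpace (P : Type*) [PartialOrder P] : Prop where
  exists_bot : ∃ b : P, IsBot b
  exists_inf : ∀ S : Set P, S.Nonempty → ∃ a, IsGLB S a

/-- The effects `𝔩_(σ,σ')` of `P`, where `σ` and `σ'` are states without common upper bound, or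
the symbol `⬝`, here the top element `⊤` of `WithTop P`. -/
structure Effect (P : Type*) [PartialOrder P] where
  pos : WithTop P
  neg : WithTop P
  incompatible : ∀ c : P, ¬ (pos ≤ (c : WithTop P) ∧ neg ≤ (c : WithTop P))

open Classical in
/-- The evaluation map `ε_𝔩(σ)`. -/
noncomputable def Effect.eval {P : Type*} [PartialOrder P] (l : Effect P) (σ : P) : BDom :=
  if l.pos ≤ (σ : WithTop P) then BDom.Y
  else if l.neg ≤ (σ : WithTop P) then BDom.N
  else BDom.bot

/-- The effects `𝔩_(σ,σ')` with `σ, σ'` non-bottom elements of `R` and `σ' ≥ σ⋆`, together with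
`𝔩_(σ,⬝)`, `𝔩_(⬝,σ)` for `σ ∈ R`, and `𝔩_(⬝,⬝)`. -/
def realEffectsOf {P : Type*} [PartialOrder P] (R : Set P) (star : P → P) : Set (Effect P) :=
  {l | (∃ σ ∈ R, ∃ σ' ∈ R, ¬ IsBot σ ∧ ¬ IsBot σ' ∧ star σ ≤ σ' ∧
          l.pos = (σ : WithTop P) ∧ l.neg = (σ' : WithTop P)) ∨
       (∃ σ ∈ R, l.pos = (σ : WithTop P) ∧ l.neg = ⊤) ∨
       (∃ σ ∈ R, l.pos = ⊤ ∧ l.neg = (σ : WithTop P)) ∨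
       (l.pos = ⊤ ∧ l.neg = ⊤)}

/-- A real structure on a space of states `P`: the set `carrier` of real states and the involution
`star` on the non-bottom real states (the values of `star` elsewhere play no role). -/
structure RealStructure (P : Type*) [PartialOrder P] where
  carrier : Set P
  bot : P
  star : P → P
  isBot_bot : IsBot bot
  bot_mem : bot ∈ carrier
  inf_mem : ∀ S ⊆ carrier, S.Nonempty → ∃ a ∈ carrier, IsGLB S a
  generated : ∀ σ ∈ carrier, IsGLB {p | Maximal (· ∈ carrier) p ∧ σ ≤ p} σ
  star_mem : ∀ σ ∈ carrier, ¬ IsBot σ → star σ ∈ carrier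
  star_not_bot : ∀ σ ∈ carrier, ¬ IsBot σ → ¬ IsBot (star σ)
  star_star : ∀ σ ∈ carrier, ¬ IsBot σ → star (star σ) = σ
  star_antitone : ∀ σ ∈ carrier, ∀ τ ∈ carrier, ¬ IsBot σ → ¬ IsBot τ →
    σ ≤ τ → star τ ≤ star σ
  star_incompatible : ∀ σ ∈ carrier, ¬ IsBot σ → ¬ BddAbove {σ, star σ}
  separated : ∀ σ σ' : P,
    (∀ l ∈ realEffectsOf carrier star, l.eval σ = l.eval σ') ↔ σ = σ'

/-- The real effects. -/
def RealStructure.effects {P : Type*} [PartialOrder P] (ρ : RealStructure P) : Set (Effect P) :=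
  realEffectsOf ρ.carrier ρ.star

/-! ### Ontic completions -/

section Ontic

variable {A : Type*} [PartialOrder A]

/-- The conditions under which the ontic completion of `(A, s)` is formed: `A` is a space of
states, it is generated by its maximal elements, and `s` is an order-reversing involution of the
non-bottom elements such that `σ` and `s σ` never have a common upper bound. -/
structure IsRealSpace (s : A → A) : Prop where
  stateSpace : IsStateSpace A
  generated : ∀ σ : A, IsGLB {p | IsMax p ∧ σ ≤ p} σ
  star_not_bot : ∀ σ : A, ¬ IsBot σ → ¬ IsBot (s σ)
  star_star : ∀ σ : A, ¬ IsBot σ → s (s σ) = σ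
  star_antitone : ∀ σ τ : A, ¬ IsBot σ → ¬ IsBot τ → σ ≤ τ → s τ ≤ s σ
  star_incompatible : ∀ σ : A, ¬ IsBot σ → ¬ BddAbove {σ, s σ}

/-- The preorder `⊑` on subsets. -/
def SubLE (U V : Set A) : Prop := ∀ σ ∈ U, ∃ τ ∈ V, σ ≤ τ

/-- The finite rank condition: the supremum of a bounded `U` is the supremum of a finite
`V ⊑ U`. -/
def FiniteRankCondition (A : Type*) [PartialOrder A] : Prop :=
  ∀ U : Set A, BddAbove U →
    ∃ V : Set A, V.Finite ∧ SubLE V U ∧ ∃ t, IsLUB U t ∧ IsLUB V t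

/-- The set of maximal elements of a subset. -/
def maxSet (U : Set A) : Set A := {σ | Maximal (· ∈ U) σ}

/-- `𝔠(U) = Max {⨆ V | V ⊑ U, V bounded above}`. -/
def preClosure (U : Set A) : Set A :=
  maxSet {σ | ∃ V : Set A, SubLE V U ∧ BddAbove V ∧ IsLUB V σ}

/-- `cl_c(U)`, the supremum for `⊑` of the iterates `𝔠ⁿ(U)`, `n ≥ 1`, presented by its maximal
elements. -/
def onticClosure (U : Set A) : Set A := maxSet (⋃ n : ℕ, preClosure^[n + 1] U)

/-- The sets `U` of non-bottom elements with `σ⋆ ≰ σ'` for all `σ, σ' ∈ U`. -/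
def consistentSets (s : A → A) : Set (Set A) :=
  {U | (∀ σ ∈ U, ¬ IsBot σ) ∧ ∀ σ ∈ U, ∀ σ' ∈ U, ¬ s σ ≤ σ'}

/-- The admissible sets `Q_c`. -/
def admissibleSets (s : A → A) : Set (Set A) :=
  {U | ((∀ σ ∈ U, ¬ IsBot σ) ∧ onticClosure U ∈ consistentSets s) ∨ ∃ b, IsBot b ∧ U = {b}}

/-- The ontic completion `cl_c(Q_c)` of `(A, s)`. -/
def OnticCompletion (s : A → A) : Type _ :=
  {J : Set A // J ∈ onticClosure '' admissibleSets s}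

/-- The set of elements of `A` underlying an element of the ontic completion. -/
def OnticCompletion.toSet {s : A → A} (J : OnticCompletion s) : Set A := J.1

theorem OnticCompletion.subset_of_le {s : A → A} {J J' : OnticCompletion s}
    (h : SubLE J.1 J'.1) (h' : SubLE J'.1 J.1) : J.1 ⊆ J'.1 := by
  intro σ hσ
  obtain ⟨τ, hτ, hle⟩ := h σ hσ
  obtain ⟨κ, hκ, hle'⟩ := h' τ hτ
  obtain ⟨U, _, hU⟩ := J.2
  rw [← hU] at hσ hκ
  have hσκ : κ ≤ σ := hσ.2 hκ.1 (hle.trans hle')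
  have : σ = τ := le_antisymm hle (hle'.trans hσκ)
  exact this ▸ hτ

/-- The ontic completion is ordered by `⊑`. -/
instance (s : A → A) : PartialOrder (OnticCompletion s) where
  le J J' := SubLE J.1 J'.1
  le_refl J := fun σ hσ => ⟨σ, hσ, le_rfl⟩
  le_trans J J' J'' h h' := fun σ hσ => by
    obtain ⟨τ, hτ, hle⟩ := h σ hσ
    obtain ⟨κ, hκ, hle'⟩ := h' τ hτ
    exact ⟨κ, hκ, hle.trans hle'⟩
  le_antisymm J J' h h' := Subtype.ext
    (Subset.antisymm (OnticCompletion.subset_of_le h h') (OnticCompletion.subset_of_le h' h))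

/-- The real structure `ρ` on the ontic completion of `(A, s)` is the one given by `(A, s)`: its
real states are the `{σ}` with `σ` in `A`, all of which occur, and `{σ}⋆ = {s σ}`. -/
structure IsOnticRealStructure {s : A → A} (ρ : RealStructure (OnticCompletion s)) : Prop where
  exists_singleton : ∀ σ : A, ∃ J : OnticCompletion s, J.toSet = {σ}
  mem_carrier : ∀ J : OnticCompletion s, J ∈ ρ.carrier ↔ ∃ σ : A, J.toSet = {σ}
  star_singleton : ∀ σ : A, ¬ IsBot σ → ∀ J : OnticCompletion s, J.toSet = {σ} →
    (ρ.star J).toSet = {s σ}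

end Ontic

/-! ### The minimal tensor product -/

section Tensor

variable {P Q : Type*} [PartialOrder P] [PartialOrder Q]

/-- `⋀ᵢ ε_𝔩A(σᵢ) • ε_𝔩B(τᵢ)` for a set `u` of pairs `(σᵢ, τᵢ)` of real states. -/
noncomputable def jointEval (ρA : RealStructure P) (ρB : RealStructure Q)
    (lA : Effect P) (lB : Effect Q) (u : Set (ρA.carrier × ρB.carrier)) : BDom :=
  BDom.meet ((fun p => BDom.mul (lA.eval (p.1 : P)) (lB.eval (p.2 : Q))) '' u)

/-- Two non-empty sets of pairs of real states are identified when no pair of real effects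
distinguishes them. -/
def tensorSetoid (ρA : RealStructure P) (ρB : RealStructure Q) :
    Setoid {u : Set (ρA.carrier × ρB.carrier) // u.Nonempty} where
  r u v := ∀ lA ∈ ρA.effects, ∀ lB ∈ ρB.effects,
    jointEval ρA ρB lA lB u.1 = jointEval ρA ρB lA lB v.1
  iseqv :=
    { refl := fun _ _ _ _ _ => rfl
      symm := fun h lA hA lB hB => (h lA hA lB hB).symm
      trans := fun h h' lA hA lB hB => (h lA hA lB hB).trans (h' lA hA lB hB) }

/-- The minimal tensor product of the two sets of real states. -/
def MinTensor (ρA : RealStructure P) (ρB : RealStructure Q) : Type _ :=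
  Quotient (tensorSetoid ρA ρB)

namespace MinTensor

variable {ρA : RealStructure P} {ρB : RealStructure Q}

/-- The class of a non-empty set `u = {(σᵢ, τᵢ)}`, i.e. the mixture of the `σᵢ ⊗ τᵢ`. -/
def mk (u : Set (ρA.carrier × ρB.carrier)) (hu : u.Nonempty) : MinTensor ρA ρB :=
  Quotient.mk (tensorSetoid ρA ρB) ⟨u, hu⟩

/-- The pure tensor `σ ⊗ τ`. -/
def tmul (σ : ρA.carrier) (τ : ρB.carrier) : MinTensor ρA ρB :=
  mk {(σ, τ)} (singleton_nonempty _)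

/-- The evaluation of a pair of real effects on the minimal tensor product. -/
noncomputable def nu (lA : ρA.effects) (lB : ρB.effects) (x : MinTensor ρA ρB) : BDom :=
  Quotient.lift (s := tensorSetoid ρA ρB) (fun u => jointEval ρA ρB lA.1 lB.1 u.1)
    (fun _ _ h => h lA.1 lA.2 lB.1 lB.2) x

/-- `x ≤ y` iff every pair of real effects takes a smaller value at `x` than at `y`. -/
instance : PartialOrder (MinTensor ρA ρB) where
  le x y := ∀ (lA : ρA.effects) (lB : ρB.effects), nu lA lB x ≤ nu lA lB y
  le_refl _ _ _ := le_rfl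
  le_trans _ _ _ h h' lA lB := (h lA lB).trans (h' lA lB)
  le_antisymm x y h h' := by
    induction x using Quotient.inductionOn
    induction y using Quotient.inductionOn
    exact Quotient.sound (s := tensorSetoid ρA ρB)
      (fun lA hA lB hB => le_antisymm (h ⟨lA, hA⟩ ⟨lB, hB⟩) (h' ⟨lA, hA⟩ ⟨lB, hB⟩))

/-- The bottom elements of the factors. -/
def botL (ρA : RealStructure P) : ρA.carrier := ⟨ρA.bot, ρA.bot_mem⟩

/-- For real states `α'`, `β'`, the element `α' ⊗ ⊥ ⊓ ⊥ ⊗ β'`. -/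
def corner (α' : ρA.carrier) (β' : ρB.carrier) : MinTensor ρA ρB :=
  mk {(α', botL ρB), (botL ρA, β')} (insert_nonempty _ _)

/-- The elements `(α ⊗ β)⋆ = α⋆ ⊗ ⊥ ⊓ ⊥ ⊗ β⋆`, for `α`, `β` pure with `σ ≤ α ⊗ β`. -/
def starSet (σ : MinTensor ρA ρB) : Set (MinTensor ρA ρB) :=
  {x | ∃ (α α' : ρA.carrier) (β β' : ρB.carrier),
    Maximal (· ∈ ρA.carrier) (α : P) ∧ Maximal (· ∈ ρB.carrier) (β : Q) ∧
    (α' : P) = ρA.star α ∧ (β' : Q) = ρB.star β ∧ σ ≤ tmul α β ∧ x = corner α' β'}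

open Classical in
/-- The star of `σ`: the supremum of the `(α ⊗ β)⋆`, for `α`, `β` pure with `σ ≤ α ⊗ β`. -/
noncomputable def star (ρA : RealStructure P) (ρB : RealStructure Q) (σ : MinTensor ρA ρB) :
    MinTensor ρA ρB :=
  if h : ∃ t, IsLUB (starSet σ) t then h.choose else σ

end MinTensor

/-! ### The requirements on the description of bipartite experiments -/

/-- A map of posets which preserves the infima of non-empty families. -/
def PreservesInf {X Y : Type*} [PartialOrder X] [PartialOrder Y] (f : X → Y) : Prop :=
  ∀ (S : Set X) (a : X), S.Nonempty → IsGLB S a → IsGLB (f '' S) (f a)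

/-- The requirements on a space `T` of bipartite states, equipped with a real structure `ρ` and a
map `tens` sending two real states to their tensor product. -/
structure BipartiteRequirements (ρA : RealStructure P) (ρB : RealStructure Q)
    {T : Type*} [PartialOrder T] (ρ : RealStructure T)
    (tens : ρA.carrier → ρB.carrier → T) : Prop where
  /-- Mixtures exist, and there is a completely mixed state. -/
  stateSpace : IsStateSpace T
  /-- The bottom element is `⊥ ⊗ ⊥`. -/
  bot_eq : ρ.bot = tens (MinTensor.botL ρA) (MinTensor.botL ρB)
  /-- Pure tensors are real states. -/
  tens_mem : ∀ σ τ, tens σ τ ∈ ρ.carrier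
  /-- Every real bipartite state is a mixture of pure tensors. -/
  exists_mixture : ∀ x ∈ ρ.carrier, ∃ u : Set (ρA.carrier × ρB.carrier), u.Nonempty ∧
    IsGLB ((fun p => tens p.1 p.2) '' u) x
  /-- Local tomography. -/
  tomography : ∀ u v : Set (ρA.carrier × ρB.carrier), u.Nonempty → v.Nonempty →
    ∀ x ∈ ρ.carrier, ∀ y ∈ ρ.carrier,
    IsGLB ((fun p => tens p.1 p.2) '' u) x → IsGLB ((fun p => tens p.1 p.2) '' v) y →
    (∀ lA ∈ ρA.effects, ∀ lB ∈ ρB.effects,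
      jointEval ρA ρB lA lB u = jointEval ρA ρB lA lB v) → x = y
  /-- Infima are preserved in the first argument. -/
  bimorphic_left : ∀ (S : Set ρA.carrier) (a : ρA.carrier) (b : ρB.carrier), S.Nonempty →
    IsGLB ((fun σ : ρA.carrier => (σ : P)) '' S) (a : P) →
    IsGLB ((fun σ => tens σ b) '' S) (tens a b)
  /-- Infima are preserved in the second argument. -/
  bimorphic_right : ∀ (a : ρA.carrier) (S : Set ρB.carrier) (b : ρB.carrier), S.Nonempty →
    IsGLB ((fun τ : ρB.carrier => (τ : Q)) '' S) (b : Q) →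
    IsGLB ((fun τ => tens a τ) '' S) (tens a b)
  /-- The first partial trace, `⨅ σᵢ ⊗ τᵢ ↦ ⨅ σᵢ`. -/
  trace_left : ∃ ζ : ρ.carrier → ρA.carrier, PreservesInf ζ ∧
    ∀ (u : Set (ρA.carrier × ρB.carrier)) (x : ρ.carrier), u.Nonempty →
      IsGLB ((fun p => tens p.1 p.2) '' u) (x : T) → IsGLB (Prod.fst '' u) (ζ x)
  /-- The second partial trace, `⨅ σᵢ ⊗ τᵢ ↦ ⨅ τᵢ`. -/
  trace_right : ∃ ζ : ρ.carrier → ρB.carrier, PreservesInf ζ ∧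
    ∀ (u : Set (ρA.carrier × ρB.carrier)) (x : ρ.carrier), u.Nonempty →
      IsGLB ((fun p => tens p.1 p.2) '' u) (x : T) → IsGLB (Prod.snd '' u) (ζ x)

end Tensor

/-! ### State spaces with the ascending chain condition -/

section Chain

variable {A : Type*} [PartialOrder A]

/-! Under the ascending chain condition, `J ↦ lowerClosure J` identifies the ontic completion with
the lower sets that are closed under existing suprema and never contain a non-bottom σ together with
σ⋆. Indeed, passing to maximal elements loses nothing up to lower closure, and every bounded
supremum is the supremum of a finite subset, so that ω iterations of 𝔠 suffice
(`isSupIdeal_lowerClosure_onticClosure`, `OnticCompletion.exists_of_isSupIdeal`,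
`OnticCompletion.star_notMem`). Infima become intersections, singletons become principal ideals, and
the effects 𝔩_(σ,⬝) alone separate points. Hence `OnticCompletion.exists_isOnticRealStructure`
serves the factors and the tensor product alike, once the latter is known to satisfy the basic
conditions and the chain condition.

In the minimal tensor product the negative effects decide the order (`MinTensor.mk_le_mk`), because
σ and σ⋆ are incompatible. An element is therefore determined by the elements `corner c d` below it,
and also by the pure tensors above it; the two kinds are related by `corner c d ≤ tmul a b ↔ c ≤ a ∨
d ≤ b`. The star is the duality that exchanges them (`MinTensor.star_le_tmul_iff`,
`MinTensor.corner_star_le`), which makes it an involution.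

The chain condition passes to the tensor product because any system of alternatives `c ≤ a ∨ d ≤ b`
reduces to a finite one (`MinTensor.exists_finite_subsystem`). Bimorphism and partial traces are
read off from the corners. -/

theorem IsStateSpace.exists_isLUB (hA : IsStateSpace A) {U : Set A} (hU : BddAbove U) :
    ∃ t, IsLUB U t := by
  obtain ⟨t, ht⟩ := hA.exists_inf _ hU
  exact ⟨t, isGLB_upperBounds.1 ht⟩

theorem exists_ge_mem_maxSet [WellFoundedGT A] {U : Set A} {x : A} (hx : x ∈ U) :
    ∃ m ∈ maxSet U, x ≤ m := by
  obtain ⟨m, ⟨hm, hxm⟩, hmax⟩ := wellFounded_gt.has_min {y | y ∈ U ∧ x ≤ y} ⟨x, hx, le_rfl⟩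
  refine ⟨m, ⟨hm, fun y hy hmy => ?_⟩, hxm⟩
  by_contra h
  exact hmax y ⟨hy, hxm.trans hmy⟩ (lt_of_le_not_ge hmy h)

/-- By the chain condition each element lies below a maximal one. This makes every `Max` in the
definition of the closure harmless. -/
theorem lowerClosure_maxSet [WellFoundedGT A] (U : Set A) :
    lowerClosure (maxSet U) = lowerClosure U := by
  refine le_antisymm (lowerClosure_mono fun x hx => hx.1) (lowerClosure_le.2 fun x hx => ?_)
  obtain ⟨m, hm, hxm⟩ := exists_ge_mem_maxSet hx
  exact mem_lowerClosure.2 ⟨m, hm, hxm⟩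

/-- Among the suprema of finite subsets of `U` there is a maximal one. Adjoining one more element of
`U` cannot enlarge it, so it bounds `U`. -/
theorem IsStateSpace.exists_finite_isLUB [WellFoundedGT A] (hA : IsStateSpace A) {U : Set A}
    (hU : BddAbove U) : ∃ V ⊆ U, V.Finite ∧ ∃ t, IsLUB U t ∧ IsLUB V t := by
  obtain ⟨b, hb⟩ := hA.exists_bot
  obtain ⟨m, ⟨⟨V, hVU, hV, hm⟩, hmax⟩, -⟩ := exists_ge_mem_maxSet
    (U := {t | ∃ V ⊆ U, V.Finite ∧ IsLUB V t}) (x := b)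
    ⟨∅, empty_subset _, finite_empty, isLUB_empty_iff.2 hb⟩
  refine ⟨V, hVU, hV, m, ⟨fun u hu => ?_, fun c hc => hm.2 fun v hv => hc (hVU hv)⟩, hm⟩
  have hsub : insert u V ⊆ U := insert_subset hu hVU
  obtain ⟨t, ht⟩ := hA.exists_isLUB (hU.mono hsub)
  have hmt : m ≤ t := hm.2 fun v hv => ht.1 (mem_insert_of_mem _ hv)
  exact (ht.1 (mem_insert _ _)).trans (hmax ⟨_, hsub, hV.insert u, ht⟩ hmt)

theorem IsStateSpace.finiteRankCondition [WellFoundedGT A] (hA : IsStateSpace A) :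
    FiniteRankCondition A := by
  intro U hU
  obtain ⟨V, hVU, hV, t, ht⟩ := hA.exists_finite_isLUB hU
  exact ⟨V, hV, fun v hv => ⟨v, hVU hv, le_rfl⟩, t, ht⟩

theorem IsRealSpace.exists_isMax_ge {s : A → A} (hs : IsRealSpace s) (σ : A) :
    ∃ p, IsMax p ∧ σ ≤ p := by
  by_contra! h
  have hσ := (hs.generated σ).2
  refine h σ (fun x _ => hσ ?_) le_rfl
  rintro p ⟨hp, hle⟩
  exact absurd hle (h p hp)

theorem IsRealSpace.le_of_forall_isMax {s : A → A} (hs : IsRealSpace s) {σ τ : A}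
    (h : ∀ p, IsMax p → τ ≤ p → σ ≤ p) : σ ≤ τ :=
  (hs.generated τ).2 fun p hp => h p hp.1 hp.2

theorem IsRealSpace.not_star_le {s : A → A} (hs : IsRealSpace s) {σ τ : A} (hσ : ¬ IsBot σ)
    (h : σ ≤ τ) : ¬ s σ ≤ τ := fun h' =>
  hs.star_incompatible σ hσ ⟨τ, by rintro x (rfl | rfl) <;> assumption⟩

end Chain

/-! ### Evaluation of effects -/

namespace Effect

variable {P : Type*} [PartialOrder P]

theorem eval_eq_Y {l : Effect P} {σ : P} : l.eval σ = BDom.Y ↔ l.pos ≤ (σ : WithTop P) := by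
  unfold eval
  split_ifs <;> simp_all

theorem eval_eq_N {l : Effect P} {σ : P} : l.eval σ = BDom.N ↔ l.neg ≤ (σ : WithTop P) := by
  have := l.incompatible σ
  unfold eval
  split_ifs <;> simp_all

end Effect

/-! ### Ontic completions and consistent ideals -/

section Ideal

variable {A : Type*} [PartialOrder A]

/-- Lower sets which are closed under all existing suprema. -/
structure IsSupIdeal (I : Set A) : Prop where
  lower : IsLowerSet I
  sup_mem : ∀ V ⊆ I, ∀ t, IsLUB V t → t ∈ I

theorem isSupIdeal_Iic (σ : A) : IsSupIdeal (Iic σ) :=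
  ⟨isLowerSet_Iic σ, fun _ hV _ ht => ht.2 hV⟩

theorem isSupIdeal_sInter {F : Set (Set A)} (hF : ∀ I ∈ F, IsSupIdeal I) : IsSupIdeal (⋂₀ F) :=
  ⟨isLowerSet_sInter fun I hI => (hF I hI).lower,
    fun V hV t ht I hI => (hF I hI).sup_mem V (fun _ hv => hV hv I hI) t ht⟩

theorem IsSupIdeal.preClosure_subset {I U : Set A} (hI : IsSupIdeal I) (hU : U ⊆ I) :
    preClosure U ⊆ I := by
  rintro t ⟨⟨V, hV, -, ht⟩, -⟩
  refine hI.sup_mem V (fun v hv => ?_) t ht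
  obtain ⟨u, hu, hvu⟩ := hV v hv
  exact hI.lower hvu (hU hu)

theorem IsSupIdeal.iterate_preClosure_subset {I U : Set A} (hI : IsSupIdeal I) (hU : U ⊆ I)
    (n : ℕ) : preClosure^[n] U ⊆ I := by
  induction n with
  | zero => exact hU
  | succ n ih => rw [Function.iterate_succ_apply']; exact hI.preClosure_subset ih

theorem IsSupIdeal.onticClosure_subset {I U : Set A} (hI : IsSupIdeal I) (hU : U ⊆ I) :
    onticClosure U ⊆ I := fun _ hx =>
  iUnion_subset (fun n => hI.iterate_preClosure_subset hU (n + 1)) hx.1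

namespace OnticCompletion

variable {s : A → A}

theorem le_iff {J J' : OnticCompletion s} :
    J ≤ J' ↔ J.1 ⊆ lowerClosure J'.1 :=
  forall₂_congr fun _ _ => mem_lowerClosure.symm

theorem le_iff_lowerClosure_le {J J' : OnticCompletion s} :
    J ≤ J' ↔ lowerClosure J.1 ≤ lowerClosure J'.1 :=
  le_iff.trans lowerClosure_le.symm

/-- Consistency is imposed only on the maximal elements of the ideal; since the star reverses the
order, it descends to everything below them. -/
theorem star_notMem (hs : IsRealSpace s) (J : OnticCompletion s) {σ : A} (hσ : ¬ IsBot σ)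
    (h : σ ∈ lowerClosure J.1) : s σ ∉ lowerClosure J.1 := by
  intro h'
  obtain ⟨U, hadm, hU⟩ := J.2
  obtain ⟨τ, hτ, hστ⟩ := mem_lowerClosure.1 h
  rcases hadm with ⟨-, hK⟩ | ⟨b, hb, rfl⟩
  · obtain ⟨κ, hκ, hσκ⟩ := mem_lowerClosure.1 h'
    rw [hU] at hK
    exact hK.2 τ hτ κ hκ ((hs.star_antitone σ τ hσ (hK.1 τ hτ) hστ).trans hσκ)
  -- The closure of `{b}` stays below `b`, so it has no non-bottom element at all.
  · rw [← hU] at hτ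
    exact hσ fun x =>
      (hστ.trans ((isSupIdeal_Iic b).onticClosure_subset (by simp) hτ)).trans (hb x)

end OnticCompletion

variable [WellFoundedGT A]

theorem mem_lowerClosure_preClosure {U V : Set A} {t : A} (hV : V ⊆ lowerClosure U)
    (ht : IsLUB V t) : t ∈ lowerClosure (preClosure U) := by
  rw [preClosure, lowerClosure_maxSet]
  exact subset_lowerClosure ⟨V, fun v hv => mem_lowerClosure.1 (hV hv), ht.bddAbove, ht⟩

theorem lowerClosure_le_preClosure (U : Set A) : lowerClosure U ≤ lowerClosure (preClosure U) :=
  lowerClosure_le.2 fun _ hu => mem_lowerClosure_preClosure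
    (singleton_subset_iff.2 (subset_lowerClosure hu)) isLUB_singleton

theorem monotone_lowerClosure_iterate (U : Set A) :
    Monotone fun n => lowerClosure (preClosure^[n] U) :=
  monotone_nat_of_le_succ fun n => by
    rw [Function.iterate_succ_apply']
    exact lowerClosure_le_preClosure _

theorem mem_lowerClosure_onticClosure {U : Set A} {x : A} :
    x ∈ lowerClosure (onticClosure U) ↔ ∃ n, x ∈ lowerClosure (preClosure^[n] U) := by
  rw [onticClosure, lowerClosure_maxSet]
  constructor
  · intro hx
    obtain ⟨y, hy, hxy⟩ := mem_lowerClosure.1 hx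
    obtain ⟨n, hn⟩ := mem_iUnion.1 hy
    exact ⟨n + 1, mem_lowerClosure.2 ⟨y, hn, hxy⟩⟩
  · rintro ⟨n, hn⟩
    obtain ⟨y, hy, hxy⟩ := mem_lowerClosure.1 (monotone_lowerClosure_iterate U n.le_succ hn)
    exact mem_lowerClosure.2 ⟨y, mem_iUnion.2 ⟨n, hy⟩, hxy⟩

theorem subset_lowerClosure_onticClosure (U : Set A) :
    U ⊆ lowerClosure (onticClosure U) := fun _ hu =>
  mem_lowerClosure_onticClosure.2 ⟨0, subset_lowerClosure hu⟩

/-- A supremum may be taken over a finite subset, whose elements all appear by a common stage `N`;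
the supremum appears at stage `N + 1`. -/
theorem isSupIdeal_lowerClosure_onticClosure (hA : IsStateSpace A) (U : Set A) :
    IsSupIdeal (lowerClosure (onticClosure U) : Set A) := by
  refine ⟨(lowerClosure _).lower, fun V hV t ht => ?_⟩
  obtain ⟨V', hV'V, hV', t', ht', htV'⟩ := hA.exists_finite_isLUB ht.bddAbove
  obtain rfl := ht.unique ht'
  choose! f hf using fun v (hv : v ∈ V) => mem_lowerClosure_onticClosure.1 (hV hv)
  obtain ⟨N, hN⟩ := (hV'.image f).bddAbove
  have hsub : V' ⊆ lowerClosure (preClosure^[N] U) := fun v hv =>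
    monotone_lowerClosure_iterate U (hN (mem_image_of_mem f hv)) (hf v (hV'V hv))
  refine mem_lowerClosure_onticClosure.2 ⟨N + 1, ?_⟩
  rw [Function.iterate_succ_apply']
  exact mem_lowerClosure_preClosure hsub htV'

namespace OnticCompletion

variable {s : A → A}

theorem isSupIdeal (hs : IsRealSpace s) (J : OnticCompletion s) :
    IsSupIdeal (lowerClosure J.1 : Set A) := by
  obtain ⟨U, -, hU⟩ := J.2
  rw [← hU]
  exact isSupIdeal_lowerClosure_onticClosure hs.stateSpace U

/-- Together with `isSupIdeal` and `star_notMem`, this describes the completion as the poset of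
consistent ideals. The ideal is its own generating set, up to bottom elements. -/
theorem exists_of_isSupIdeal (hs : IsRealSpace s) {I : Set A} (hI : IsSupIdeal I)
    (hcons : ∀ σ ∈ I, ¬ IsBot σ → s σ ∉ I) :
    ∃ J : OnticCompletion s, (lowerClosure J.1 : Set A) = I := by
  obtain ⟨b, hb⟩ := hs.stateSpace.exists_bot
  have key : ∀ U ⊆ I, I ⊆ lowerClosure U → (lowerClosure (onticClosure U) : Set A) = I := by
    intro U hU hIU
    refine Subset.antisymm ?_ (hIU.trans ?_)
    · exact lowerClosure_min (hI.onticClosure_subset hU) hI.lower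
    · exact lowerClosure_min (subset_lowerClosure_onticClosure U) (lowerClosure _).lower
  by_cases h : ∃ x ∈ I, ¬ IsBot x
  · obtain ⟨x, hx, hxb⟩ := h
    -- Admissible sets other than `{⊥}` must avoid bottom elements; these come back in the lower
    -- closure, being below `x`.
    have hU := key {σ ∈ I | ¬ IsBot σ} (fun _ h => h.1) fun σ hσ => by
      by_cases hσb : IsBot σ
      · exact mem_lowerClosure.2 ⟨x, ⟨hx, hxb⟩, hσb x⟩
      · exact subset_lowerClosure ⟨hσ, hσb⟩
    refine ⟨⟨_, _, Or.inl ⟨fun σ h => h.2, ?_, ?_⟩, rfl⟩, hU⟩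
    -- A bottom element that is maximal in the closure would force `x`, which lies below some
    -- element of the closure, to be bottom.
    · intro σ hσ hσb
      obtain ⟨τ, hτ, hxτ⟩ := mem_lowerClosure.1 (hU.symm.subset hx)
      exact hxb fun y => (hxτ.trans (hσ.2 hτ.1 (hσb τ))).trans (hσb y)
    · intro σ hσ τ hτ hle
      have hσI := hU.subset (subset_lowerClosure hσ)
      have hτI := hU.subset (subset_lowerClosure hτ)
      refine hcons σ hσI (fun hσb => ?_) (hI.lower hle hτI)
      obtain ⟨τ, hτ, hxτ⟩ := mem_lowerClosure.1 (hU.symm.subset hx)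
      exact hxb fun y => (hxτ.trans (hσ.2 hτ.1 (hσb τ))).trans (hσb y)
  · push Not at h
    have hbI : b ∈ I := hI.sup_mem ∅ (empty_subset _) b (isLUB_empty_iff.2 hb)
    exact ⟨⟨_, {b}, Or.inr ⟨b, hb, rfl⟩, rfl⟩, key _ (singleton_subset_iff.2 hbI)
      fun x hx => mem_lowerClosure.2 ⟨b, rfl, h x hx b⟩⟩

/-- Infima are intersections of ideals. Any one member `J₀` of the family already guarantees
consistency of the intersection. -/
theorem isStateSpace (hs : IsRealSpace s) : IsStateSpace (OnticCompletion s) := by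
  obtain ⟨b, hb⟩ := hs.stateSpace.exists_bot
  constructor
  · obtain ⟨J, hJ⟩ := exists_of_isSupIdeal hs (isSupIdeal_Iic b)
      fun σ hσ hσb => absurd (fun x => le_trans hσ (hb x)) hσb
    refine ⟨J, fun J' => le_iff.2 ?_⟩
    refine (subset_lowerClosure.trans hJ.subset).trans fun x hx => ?_
    exact (J'.isSupIdeal hs).sup_mem ∅ (empty_subset _) x
      (isLUB_empty_iff.2 fun y => le_trans hx (hb y))
  · rintro S ⟨J₀, hJ₀⟩
    obtain ⟨J, hJ⟩ := exists_of_isSupIdeal hs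
      (isSupIdeal_sInter (F := (fun J : OnticCompletion s => (lowerClosure J.1 : Set A)) '' S)
        (by rintro _ ⟨J, -, rfl⟩; exact J.isSupIdeal hs))
      (fun σ hσ hσb hσ' => J₀.star_notMem hs hσb (hσ _ ⟨J₀, hJ₀, rfl⟩) (hσ' _ ⟨J₀, hJ₀, rfl⟩))
    refine ⟨J, fun J' hJ' => le_iff_lowerClosure_le.2 fun x hx => ?_, fun J' hJ' => ?_⟩
    · exact hJ.subset hx _ ⟨J', hJ', rfl⟩
    · refine le_iff_lowerClosure_le.2 fun x hx => hJ.symm.subset ?_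
      rintro _ ⟨K, hK, rfl⟩
      exact le_iff_lowerClosure_le.1 (hJ' hK) hx

/-- The principal ideal of `σ` is consistent by incompatibility of an element with its star; its
presentation by maximal elements can only be `{σ}`. -/
theorem exists_eq_singleton (hs : IsRealSpace s) (σ : A) :
    ∃ J : OnticCompletion s, J.toSet = {σ} := by
  obtain ⟨J, hJ⟩ := exists_of_isSupIdeal hs (isSupIdeal_Iic σ)
    fun τ hτ hτb => hs.not_star_le hτb hτ
  have hle : ∀ τ ∈ J.1, τ ≤ σ := fun τ hτ => hJ.subset (subset_lowerClosure hτ)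
  obtain ⟨τ, hτ, hστ⟩ := mem_lowerClosure.1 (hJ.symm.subset (mem_Iic.2 le_rfl))
  obtain rfl := le_antisymm (hle τ hτ) hστ
  refine ⟨J, Subset.antisymm (fun κ hκ => ?_) (singleton_subset_iff.2 hτ)⟩
  obtain ⟨U, -, hU⟩ := J.2
  have hκ' : κ ∈ J.1 := hκ
  rw [← hU] at hκ' hτ
  exact le_antisymm (hle κ hκ) (hκ'.2 hτ.1 (hle κ hκ))

/-- The element `{σ}` of the ontic completion. -/
noncomputable def principal (hs : IsRealSpace s) (σ : A) : OnticCompletion s :=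
  (exists_eq_singleton hs σ).choose

variable (hs : IsRealSpace s)

theorem toSet_principal (σ : A) : (principal hs σ).toSet = {σ} :=
  (exists_eq_singleton hs σ).choose_spec

theorem toSet_eq_singleton {J : OnticCompletion s} {σ : A} :
    J.toSet = {σ} ↔ J = principal hs σ :=
  ⟨fun h => Subtype.ext (h.trans (toSet_principal hs σ).symm), fun h => h ▸ toSet_principal hs σ⟩

theorem principal_le_iff {σ : A} {J : OnticCompletion s} :
    principal hs σ ≤ J ↔ σ ∈ lowerClosure J.1 := by
  rw [le_iff, show (principal hs σ).1 = {σ} from toSet_principal hs σ]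
  exact singleton_subset_iff

theorem le_principal_iff {σ : A} {J : OnticCompletion s} :
    J ≤ principal hs σ ↔ ∀ τ ∈ J.1, τ ≤ σ := by
  rw [le_iff, show (principal hs σ).1 = {σ} from toSet_principal hs σ]
  simp [subset_def]

theorem principal_le_principal {σ τ : A} : principal hs σ ≤ principal hs τ ↔ σ ≤ τ := by
  rw [le_principal_iff, show (principal hs σ).1 = {σ} from toSet_principal hs σ]
  simp

theorem principal_injective : Function.Injective (principal hs) := fun _ _ h =>
  le_antisymm ((principal_le_principal hs).1 h.le) ((principal_le_principal hs).1 h.ge)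

/-- A lower bound `J` in the completion need not be a singleton, but comparing it with singletons is
done element by element in `A`. -/
theorem isGLB_principal_image {S : Set A} {a : A} :
    IsGLB (principal hs '' S) (principal hs a) ↔ IsGLB S a := by
  constructor
  · refine fun h => ⟨fun x hx => (principal_le_principal hs).1 (h.1 ⟨x, hx, rfl⟩), fun x hx => ?_⟩
    refine (principal_le_principal hs).1 (h.2 ?_)
    rintro _ ⟨y, hy, rfl⟩
    exact (principal_le_principal hs).2 (hx hy)
  · intro h
    refine ⟨?_, fun J hJ => (le_principal_iff hs).2 fun τ hτ => h.2 fun x hx => ?_⟩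
    · rintro _ ⟨y, hy, rfl⟩
      exact (principal_le_principal hs).2 (h.1 hy)
    · exact (le_principal_iff hs).1 (hJ ⟨x, hx, rfl⟩) τ hτ

theorem isBot_principal {σ : A} : IsBot (principal hs σ) ↔ IsBot σ := by
  refine ⟨fun h τ => (principal_le_principal hs).1 (h _), fun h J => ?_⟩
  exact (principal_le_iff hs).2 ((J.isSupIdeal hs).sup_mem ∅ (empty_subset _) σ
    (isLUB_empty_iff.2 h))

theorem maximal_principal {σ : A} :
    Maximal (· ∈ range (principal hs)) (principal hs σ) ↔ IsMax σ := by
  constructor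
  · exact fun h τ hτ => (principal_le_principal hs).1
      (h.2 ⟨τ, rfl⟩ ((principal_le_principal hs).2 hτ))
  · refine fun h => ⟨⟨σ, rfl⟩, ?_⟩
    rintro _ ⟨τ, rfl⟩ hle
    exact (principal_le_principal hs).2 (h ((principal_le_principal hs).1 hle))

open Classical in
/-- The map `{σ} ↦ {s σ}` on the singletons in the ontic completion. -/
noncomputable def starMap (J : OnticCompletion s) : OnticCompletion s :=
  if h : ∃ σ, J = principal hs σ then principal hs (s h.choose) else J

theorem starMap_principal (σ : A) : starMap hs (principal hs σ) = principal hs (s σ) := by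
  have h : ∃ τ, principal hs σ = principal hs τ := ⟨σ, rfl⟩
  rw [starMap, dif_pos h, ← principal_injective hs h.choose_spec]

/-- The effects 𝔩_(σ,⬝) detect membership of σ in the ideal, so they suffice for separation. -/
theorem le_of_eval_eq {J J' : OnticCompletion s}
    (h : ∀ l ∈ realEffectsOf (range (principal hs)) (starMap hs), l.eval J = l.eval J') :
    J ≤ J' := by
  refine le_iff_lowerClosure_le.2 fun σ hσ => ?_
  let l : Effect (OnticCompletion s) := ⟨((principal hs σ : OnticCompletion s) : WithTop _), ⊤, by simp⟩
  have hl := h l (Or.inr (Or.inl ⟨_, ⟨σ, rfl⟩, rfl, rfl⟩))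
  have hJ : l.eval J = BDom.Y :=
    Effect.eval_eq_Y.2 (WithTop.coe_le_coe.2 ((principal_le_iff hs).2 hσ))
  exact (principal_le_iff hs).1 (WithTop.coe_le_coe.1 (Effect.eval_eq_Y.1 (hl.symm.trans hJ)))

theorem exists_isOnticRealStructure (hs : IsRealSpace s) :
    ∃ ρ : RealStructure (OnticCompletion s), IsOnticRealStructure ρ := by
  obtain ⟨b, hb⟩ := hs.stateSpace.exists_bot
  have hnb : ∀ {σ}, ¬ IsBot (principal hs σ) → ¬ IsBot σ := fun h h' => h ((isBot_principal hs).2 h')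
  refine ⟨{ carrier := range (principal hs), bot := principal hs b, star := starMap hs
            isBot_bot := (isBot_principal hs).2 hb, bot_mem := mem_range_self b
            inf_mem := ?_, generated := ?_, star_mem := ?_, star_not_bot := ?_, star_star := ?_
            star_antitone := ?_, star_incompatible := ?_, separated := ?_ }, ?_⟩
  · intro S hS hne
    obtain ⟨S, rfl⟩ := subset_range_iff_exists_image_eq.1 hS
    obtain ⟨a, ha⟩ := hs.stateSpace.exists_inf S hne.of_image
    exact ⟨_, ⟨a, rfl⟩, (isGLB_principal_image hs).2 ha⟩
  · rintro _ ⟨σ, rfl⟩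
    convert (isGLB_principal_image hs).2 (hs.generated σ) using 1
    ext J
    constructor
    · rintro ⟨hJ, hle⟩
      obtain ⟨τ, rfl⟩ := hJ.1
      exact ⟨τ, ⟨(maximal_principal hs).1 hJ, (principal_le_principal hs).1 hle⟩, rfl⟩
    · rintro ⟨τ, ⟨hτ, hle⟩, rfl⟩
      exact ⟨(maximal_principal hs).2 hτ, (principal_le_principal hs).2 hle⟩
  · rintro _ ⟨σ, rfl⟩ -
    exact ⟨s σ, (starMap_principal hs σ).symm⟩
  · rintro _ ⟨σ, rfl⟩ h
    rw [starMap_principal, isBot_principal]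
    exact hs.star_not_bot σ (hnb h)
  · rintro _ ⟨σ, rfl⟩ h
    rw [starMap_principal, starMap_principal, hs.star_star σ (hnb h)]
  · rintro _ ⟨σ, rfl⟩ _ ⟨τ, rfl⟩ hσ hτ hle
    rw [starMap_principal, starMap_principal, principal_le_principal]
    exact hs.star_antitone σ τ (hnb hσ) (hnb hτ) ((principal_le_principal hs).1 hle)
  · rintro _ ⟨σ, rfl⟩ h ⟨J, hJ⟩
    rw [starMap_principal] at hJ
    exact J.star_notMem hs (hnb h) ((principal_le_iff hs).1 (hJ (by simp)))
      ((principal_le_iff hs).1 (hJ (by simp)))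
  · intro J J'
    refine ⟨fun h => le_antisymm (le_of_eval_eq hs h)
      (le_of_eval_eq hs fun l hl => (h l hl).symm), ?_⟩
    rintro rfl _ _
    rfl
  · refine ⟨exists_eq_singleton hs, fun J => exists_congr fun σ => ?_, fun σ _ J hJ => ?_⟩
    · rw [toSet_eq_singleton hs, eq_comm]
    · obtain rfl := (toSet_eq_singleton hs).1 hJ
      exact (congrArg toSet (starMap_principal hs σ)).trans (toSet_principal hs (s σ))

end OnticCompletion

end Ideal

/-! ### The real states of an ontic completion -/

namespace IsOnticRealStructure

open OnticCompletion

variable {A : Type*} [PartialOrder A] [WellFoundedGT A] {s : A → A} (hs : IsRealSpace s)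
  {ρ : RealStructure (OnticCompletion s)}

theorem mem_carrier_iff (hρ : IsOnticRealStructure ρ) {J : OnticCompletion s} :
    J ∈ ρ.carrier ↔ ∃ σ, J = principal hs σ := by
  simp only [hρ.mem_carrier, toSet_eq_singleton hs]

/-- The real states of the ontic completion form a copy of the given poset. -/
noncomputable def equiv (hρ : IsOnticRealStructure ρ) : A ≃o ρ.carrier where
  toEquiv := Equiv.ofBijective
    (fun σ => (⟨principal hs σ, (hρ.mem_carrier_iff hs).2 ⟨σ, rfl⟩⟩ : ρ.carrier))
    ⟨fun _ _ h => principal_injective hs (congrArg Subtype.val h), fun J => by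
      obtain ⟨σ, hσ⟩ := (hρ.mem_carrier_iff hs).1 J.2
      exact ⟨σ, Subtype.ext hσ.symm⟩⟩
  map_rel_iff' := principal_le_principal hs

end IsOnticRealStructure

/-! ### Arithmetic of the flat domain -/

namespace BDom

theorem le_iff {u v : BDom} : u ≤ v ↔ (u = Y → v = Y) ∧ (u = N → v = N) := by
  change (u = bot ∨ u = v) ↔ _
  cases u <;> cases v <;> simp

theorem mul_eq_Y {u v : BDom} : mul u v = Y ↔ u = Y ∧ v = Y := by
  cases u <;> cases v <;> simp [mul]

theorem mul_eq_N {u v : BDom} : mul u v = N ↔ u = N ∨ v = N := by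
  cases u <;> cases v <;> simp [mul]

theorem meet_eq_Y {S : Set BDom} : meet S = Y ↔ ∀ x ∈ S, x = Y := by
  unfold meet
  split_ifs with h1 h2
  · exact iff_of_true rfl h1
  · exact iff_of_false nofun h1
  · exact iff_of_false nofun h1

theorem meet_eq_N {S : Set BDom} (hS : S.Nonempty) : meet S = N ↔ ∀ x ∈ S, x = N := by
  obtain ⟨a, ha⟩ := hS
  unfold meet
  split_ifs with h1 h2
  · refine iff_of_false nofun fun h => absurd ((h1 a ha).symm.trans (h a ha)) (by simp)
  · exact iff_of_true rfl h2
  · exact iff_of_false nofun h2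

end BDom

/-! ### The poset of real states -/

namespace RealStructure

variable {P : Type*} [PartialOrder P] (ρ : RealStructure P)

theorem isBot_coe_iff {c : ρ.carrier} : IsBot (c : P) ↔ IsBot c :=
  ⟨fun h d => h d, fun h x => le_trans (h ⟨ρ.bot, ρ.bot_mem⟩ : (c : P) ≤ ρ.bot) (ρ.isBot_bot x)⟩

theorem maximal_coe_iff {c : ρ.carrier} : Maximal (· ∈ ρ.carrier) (c : P) ↔ IsMax c :=
  ⟨fun h d hd => h.2 d.2 hd, fun h => ⟨c.2, fun _ hd hle => h (b := ⟨_, hd⟩) hle⟩⟩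

/-- Real states are closed under infima taken in `P`, so an infimum among real states is also one in
`P`. -/
theorem isGLB_coe_image_iff {S : Set ρ.carrier} {a : ρ.carrier} (hS : S.Nonempty) :
    IsGLB ((fun c : ρ.carrier => (c : P)) '' S) (a : P) ↔ IsGLB S a := by
  constructor
  · refine fun h => ⟨fun c hc => h.1 ⟨c, hc, rfl⟩, fun d hd => h.2 ?_⟩
    rintro _ ⟨c, hc, rfl⟩
    exact hd hc
  · intro h
    obtain ⟨m, hm, hglb⟩ := ρ.inf_mem ((fun c : ρ.carrier => (c : P)) '' S)
      (by rintro _ ⟨c, -, rfl⟩; exact c.2) (hS.image _)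
    have : IsGLB S (⟨m, hm⟩ : ρ.carrier) := by
      refine ⟨fun c hc => hglb.1 ⟨c, hc, rfl⟩, fun d hd => hglb.2 ?_⟩
      rintro _ ⟨c, hc, rfl⟩
      exact hd hc
    rwa [h.unique this]

open Classical in
/-- The star as a map on the real states. -/
noncomputable def starMap (c : ρ.carrier) : ρ.carrier :=
  if h : IsBot (c : P) then c else ⟨ρ.star c, ρ.star_mem c c.2 h⟩

theorem coe_starMap {c : ρ.carrier} (h : ¬ IsBot c) : (ρ.starMap c : P) = ρ.star c := by
  rw [starMap, dif_neg (mt ρ.isBot_coe_iff.1 h)]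

/-- From here on the tensor product is studied inside the posets of real states, without reference
to the ambient spaces. -/
theorem isRealSpace_starMap : IsRealSpace ρ.starMap where
  stateSpace := by
    refine ⟨⟨⟨ρ.bot, ρ.bot_mem⟩, fun c => ρ.isBot_bot _⟩, fun S hS => ?_⟩
    obtain ⟨m, hm, hglb⟩ := ρ.inf_mem ((fun c : ρ.carrier => (c : P)) '' S)
      (by rintro _ ⟨c, -, rfl⟩; exact c.2) (hS.image _)
    exact ⟨⟨m, hm⟩, (ρ.isGLB_coe_image_iff hS).1 hglb⟩
  generated c := by
    have h := ρ.generated c c.2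
    refine ⟨fun p hp => hp.2, fun d hd => h.2 ?_⟩
    rintro p ⟨hp, hle⟩
    exact hd (a := ⟨p, hp.1⟩) ⟨ρ.maximal_coe_iff.1 hp, hle⟩
  star_not_bot c hc := by
    rw [← isBot_coe_iff, ρ.coe_starMap hc]
    exact ρ.star_not_bot c c.2 (mt ρ.isBot_coe_iff.1 hc)
  star_star c hc := by
    have hc' := mt ρ.isBot_coe_iff.1 hc
    have h : ¬ IsBot (ρ.starMap c) := by
      rw [← isBot_coe_iff, ρ.coe_starMap hc]
      exact ρ.star_not_bot c c.2 hc'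
    refine Subtype.ext ?_
    rw [ρ.coe_starMap h, ρ.coe_starMap hc, ρ.star_star c c.2 hc']
  star_antitone c d hc hd hle := by
    rw [← Subtype.coe_le_coe, ρ.coe_starMap hc, ρ.coe_starMap hd]
    exact ρ.star_antitone c c.2 d d.2 (mt ρ.isBot_coe_iff.1 hc) (mt ρ.isBot_coe_iff.1 hd) hle
  star_incompatible c hc := by
    rintro ⟨d, hd⟩
    refine ρ.star_incompatible c c.2 (mt ρ.isBot_coe_iff.1 hc) ⟨d, ?_⟩
    rintro _ (rfl | rfl)
    · exact hd (mem_insert _ _)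
    · rw [← ρ.coe_starMap hc]
      exact hd (mem_insert_of_mem _ rfl)

variable {ρ}

/-- The real effect `𝔩_(⬝,c)`. -/
def negEffect (c : ρ.carrier) : ρ.effects :=
  ⟨⟨⊤, ((c : P) : WithTop P), by simp⟩, Or.inr (Or.inr (Or.inl ⟨c, c.2, rfl, rfl⟩))⟩

theorem effects_pos {l : Effect P} (hl : l ∈ ρ.effects) :
    l.pos = ⊤ ∨ ∃ c : ρ.carrier, l.pos = ((c : P) : WithTop P) := by
  rcases hl with ⟨c, hc, _, _, _, _, _, h, _⟩ | ⟨c, hc, h, _⟩ | ⟨_, _, h, _⟩ | ⟨h, _⟩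
  · exact Or.inr ⟨⟨c, hc⟩, h⟩
  · exact Or.inr ⟨⟨c, hc⟩, h⟩
  · exact Or.inl h
  · exact Or.inl h

theorem effects_neg {l : Effect P} (hl : l ∈ ρ.effects) :
    l.neg = ⊤ ∨ ∃ c : ρ.carrier, l.neg = ((c : P) : WithTop P) := by
  rcases hl with ⟨_, _, c, hc, _, _, _, _, h⟩ | ⟨_, _, _, h⟩ | ⟨c, hc, _, h⟩ | ⟨_, h⟩
  · exact Or.inr ⟨⟨c, hc⟩, h⟩
  · exact Or.inl h
  · exact Or.inr ⟨⟨c, hc⟩, h⟩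
  · exact Or.inl h

end RealStructure

/-! ### Order and infima in the minimal tensor product -/

section Tensor

variable {P Q : Type*} [PartialOrder P] [PartialOrder Q]
  {ρA : RealStructure P} {ρB : RealStructure Q}

theorem jointEval_eq_Y {lA : Effect P} {lB : Effect Q} {u : Set (ρA.carrier × ρB.carrier)} :
    jointEval ρA ρB lA lB u = BDom.Y ↔
      ∀ p ∈ u, lA.pos ≤ ((p.1 : P) : WithTop P) ∧ lB.pos ≤ ((p.2 : Q) : WithTop Q) := by
  rw [jointEval, BDom.meet_eq_Y, forall_mem_image]
  simp only [BDom.mul_eq_Y, Effect.eval_eq_Y]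

theorem jointEval_eq_N {lA : Effect P} {lB : Effect Q} {u : Set (ρA.carrier × ρB.carrier)}
    (hu : u.Nonempty) : jointEval ρA ρB lA lB u = BDom.N ↔
      ∀ p ∈ u, lA.neg ≤ ((p.1 : P) : WithTop P) ∨ lB.neg ≤ ((p.2 : Q) : WithTop Q) := by
  rw [jointEval, BDom.meet_eq_N (hu.image _), forall_mem_image]
  simp only [BDom.mul_eq_N, Effect.eval_eq_N]

namespace IsRealSpace

variable {A : Type*} [PartialOrder A] {s : A → A}

theorem exists_not_isBot [Nontrivial A] : ∃ a : A, ¬ IsBot a := by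
  obtain ⟨a, b, hab⟩ := exists_pair_ne A
  by_contra! h
  exact hab (le_antisymm (h a b) (h b a))

theorem not_isBot_of_isMax [Nontrivial A] {a : A} (ha : IsMax a) : ¬ IsBot a := fun h => by
  obtain ⟨b, hb⟩ := exists_not_isBot (A := A)
  exact hb fun x => (ha (h b)).trans (h x)

/-- For a non-bottom `d`, the elements `d` and `s d` are never both below `f i`; one of these two
alternatives must therefore yield `p i`. -/
theorem forall_of_forall_or [Nontrivial A] (hs : IsRealSpace s) {ι : Sort*} {p : ι → Prop}
    {f : ι → A} (h : ∀ d i, p i ∨ d ≤ f i) (i : ι) : p i := by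
  obtain ⟨d, hd⟩ := exists_not_isBot (A := A)
  rcases h d i with h1 | h1
  · exact h1
  · exact (h (s d) i).resolve_right (hs.not_star_le hd h1)

end IsRealSpace

namespace MinTensor

theorem exists_eq_mk (x : MinTensor ρA ρB) : ∃ u hu, x = mk u hu := by
  induction x using Quotient.inductionOn with
  | h u => exact ⟨u.1, u.2, rfl⟩

variable [Nontrivial ρA.carrier] [Nontrivial ρB.carrier]

/-- The right-hand side compares the values `N` of the effects 𝔩_(⬝,c), 𝔩_(⬝,d) only. The values `Y`
ask for `c ≤ p.1` and `d ≤ p.2` separately, and each of these conditions follows from the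
alternatives by letting the other component vary (`forall_of_forall_or`). -/
theorem mk_le_mk {u v : Set (ρA.carrier × ρB.carrier)} {hu : u.Nonempty} {hv : v.Nonempty} :
    mk u hu ≤ mk v hv ↔
      ∀ c d, (∀ p ∈ u, c ≤ p.1 ∨ d ≤ p.2) → ∀ p ∈ v, c ≤ p.1 ∨ d ≤ p.2 := by
  constructor
  · intro h c d
    have := (BDom.le_iff.1 (h (RealStructure.negEffect c) (RealStructure.negEffect d))).2
    change jointEval _ _ _ _ _ = _ → jointEval _ _ _ _ _ = _ at this
    rw [jointEval_eq_N hu, jointEval_eq_N hv] at this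
    simpa [RealStructure.negEffect] using this
  · intro h
    have hl : ∀ c, (∀ p ∈ u, c ≤ p.1) → ∀ p ∈ v, c ≤ p.1 := fun c hc p hp =>
      ρB.isRealSpace_starMap.forall_of_forall_or (ι := v) (p := fun p => c ≤ p.1.1)
        (f := fun p => p.1.2) (fun d p => h c d (fun p hp => Or.inl (hc p hp)) p.1 p.2) ⟨p, hp⟩
    have hr : ∀ d, (∀ p ∈ u, d ≤ p.2) → ∀ p ∈ v, d ≤ p.2 := fun d hd p hp =>
      ρA.isRealSpace_starMap.forall_of_forall_or (ι := v) (p := fun p => d ≤ p.1.2)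
        (f := fun p => p.1.1) (fun c p => (h c d (fun p hp => Or.inr (hd p hp)) p.1 p.2).symm)
        ⟨p, hp⟩
    obtain ⟨p₀, hp₀⟩ := hu
    rintro ⟨lA, hA⟩ ⟨lB, hB⟩
    refine BDom.le_iff.2 ⟨?_, ?_⟩
    · change jointEval _ _ _ _ _ = _ → jointEval _ _ _ _ _ = _
      rw [jointEval_eq_Y, jointEval_eq_Y]
      intro hY
      -- If a positive part is the symbol `⬝`, the value `Y` is not attained, since `u` contains
      -- `p₀`.
      rcases RealStructure.effects_pos hA with hc | ⟨c, hc⟩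
      · simpa [hc] using (hY p₀ hp₀).1
      rcases RealStructure.effects_pos hB with hd | ⟨d, hd⟩
      · simpa [hd] using (hY p₀ hp₀).2
      simp only [hc, hd, WithTop.coe_le_coe, Subtype.coe_le_coe] at hY ⊢
      exact fun p hp => ⟨hl c (fun p hp => (hY p hp).1) p hp, hr d (fun p hp => (hY p hp).2) p hp⟩
    · change jointEval _ _ _ _ _ = _ → jointEval _ _ _ _ _ = _
      rw [jointEval_eq_N ⟨p₀, hp₀⟩, jointEval_eq_N hv]
      rcases RealStructure.effects_neg hA with hc | ⟨c, hc⟩ <;>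
        rcases RealStructure.effects_neg hB with hd | ⟨d, hd⟩ <;>
        simp only [hc, hd, WithTop.coe_le_coe, Subtype.coe_le_coe, top_le_iff, WithTop.coe_ne_top,
          or_false, false_or]
      · exact fun h => (h p₀ hp₀).elim
      · exact hr d
      · exact hl c
      · exact h c d

/-- So `corner c d` is the least element on which the pair 𝔩_(⬝,c), 𝔩_(⬝,d) takes the value `N`. -/
theorem corner_le_mk {c : ρA.carrier} {d : ρB.carrier} {u : Set (ρA.carrier × ρB.carrier)}
    {hu : u.Nonempty} : corner c d ≤ mk u hu ↔ ∀ p ∈ u, c ≤ p.1 ∨ d ≤ p.2 := by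
  have hbA : ∀ x, botL ρA ≤ x := fun x => ρA.isBot_bot x
  have hbB : ∀ x, botL ρB ≤ x := fun x => ρB.isBot_bot x
  rw [corner, mk_le_mk]
  simp only [mem_insert_iff, mem_singleton_iff, forall_eq_or_imp, forall_eq]
  constructor
  · exact fun h => h c d ⟨Or.inl le_rfl, Or.inr le_rfl⟩
  · rintro h c' d' ⟨h1, h2⟩ p hp
    rcases h1 with h1 | h1
    · rcases h2 with h2 | h2
      · exact Or.inl (h2.trans (hbA _))
      · exact (h p hp).imp h1.trans h2.trans
    · exact Or.inr (h1.trans (hbB _))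

theorem corner_le_tmul {c a : ρA.carrier} {d b : ρB.carrier} :
    corner c d ≤ tmul a b ↔ c ≤ a ∨ d ≤ b := by
  rw [tmul, corner_le_mk]
  simp

theorem le_iff_corner {x y : MinTensor ρA ρB} :
    x ≤ y ↔ ∀ c d, corner c d ≤ x → corner c d ≤ y := by
  refine ⟨fun h c d hx => hx.trans h, fun h => ?_⟩
  obtain ⟨u, hu, rfl⟩ := exists_eq_mk x
  obtain ⟨v, hv, rfl⟩ := exists_eq_mk y
  simpa only [mk_le_mk, corner_le_mk] using h

theorem isGLB_mk (u : Set (ρA.carrier × ρB.carrier)) (hu : u.Nonempty) :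
    IsGLB ((fun p => tmul p.1 p.2) '' u) (mk u hu) := by
  constructor
  · rintro _ ⟨p, hp, rfl⟩
    exact le_iff_corner.2 fun c d h => corner_le_tmul.2 (corner_le_mk.1 h p hp)
  · refine fun y hy => le_iff_corner.2 fun c d h => corner_le_mk.2 fun p hp => ?_
    exact corner_le_tmul.1 (h.trans (hy ⟨p, hp, rfl⟩))

theorem tmul_le_tmul {a a' : ρA.carrier} {b b' : ρB.carrier} :
    tmul a b ≤ tmul a' b' ↔ a ≤ a' ∧ b ≤ b' := by
  rw [le_iff_corner]
  simp only [corner_le_tmul]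
  constructor
  · intro h
    exact ⟨ρB.isRealSpace_starMap.forall_of_forall_or (ι := Unit) (f := fun _ => b')
        (fun d _ => h a d (Or.inl le_rfl)) (),
      ρA.isRealSpace_starMap.forall_of_forall_or (ι := Unit) (f := fun _ => a')
        (fun c _ => (h c b (Or.inr le_rfl)).symm) ()⟩
  · exact fun h c d => Or.imp (fun h' => h'.trans h.1) (fun h' => h'.trans h.2)

theorem isBot_tmul {a : ρA.carrier} {b : ρB.carrier} (ha : IsBot a) (hb : IsBot b) :
    IsBot (tmul a b) := fun x => by
  obtain ⟨v, hv, rfl⟩ := exists_eq_mk x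
  rw [tmul, mk_le_mk]
  rintro c d h p -
  exact (h _ rfl).imp (fun h => h.trans (ha _)) (fun h => h.trans (hb _))

theorem isBot_corner_iff {a : ρA.carrier} {b : ρB.carrier} :
    IsBot (corner a b) ↔ IsBot a ∨ IsBot b := by
  have hbA : IsBot (botL ρA) := fun x => ρA.isBot_bot x
  have hbB : IsBot (botL ρB) := fun x => ρB.isBot_bot x
  constructor
  · exact fun h => (corner_le_tmul.1 (h (tmul (botL ρA) (botL ρB)))).imp
      (fun h x => h.trans (hbA x)) fun h x => h.trans (hbB x)
  · intro h x
    obtain ⟨v, hv, rfl⟩ := exists_eq_mk x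
    exact corner_le_mk.2 fun p _ => h.imp (fun h => h _) (fun h => h _)

theorem exists_corner_le {x : MinTensor ρA ρB} (hx : ¬ IsBot x) :
    ∃ c d, ¬ IsBot c ∧ ¬ IsBot d ∧ corner c d ≤ x := by
  by_contra! h
  refine hx fun y => le_iff_corner.2 fun c d hcd => isBot_corner_iff.2 ?_ y
  by_contra! hb
  exact h c d hb.1 hb.2 hcd

theorem isStateSpace : IsStateSpace (MinTensor ρA ρB) := by
  constructor
  · exact ⟨_, isBot_tmul (a := botL ρA) (b := botL ρB) (fun x => ρA.isBot_bot x)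
      (fun x => ρB.isBot_bot x)⟩
  · rintro S ⟨x₀, hx₀⟩
    -- The infimum of a family of classes is represented by the union of chosen representatives.
    choose f hf hfe using exists_eq_mk (ρA := ρA) (ρB := ρB)
    have hne : (⋃ x ∈ S, f x).Nonempty := by
      obtain ⟨p, hp⟩ := hf x₀
      exact ⟨p, mem_biUnion hx₀ hp⟩
    refine ⟨mk (⋃ x ∈ S, f x) hne, fun x hx => ?_, fun y hy => ?_⟩
    · conv_rhs => rw [hfe x]
      exact mk_le_mk.2 fun c d h p hp => h p (mem_biUnion hx hp)
    · refine (isGLB_mk _ hne).2 ?_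
      rintro _ ⟨p, hp, rfl⟩
      obtain ⟨x, hx, hp⟩ := mem_iUnion₂.1 hp
      refine (hy hx).trans ?_
      conv_lhs => rw [hfe x]
      exact (isGLB_mk _ (hf x)).1 ⟨p, hp, rfl⟩

/-! ### Pure states of the minimal tensor product -/

/-- If `corner c d` is not below `tmul a b`, both alternatives fail. Pure `α ≥ a` and `β ≥ b`
witnessing the two failures can be chosen independently, and `corner c d` is not below `tmul α β`.
-/
theorem le_tmul_of_forall_isMax {x : MinTensor ρA ρB} {a : ρA.carrier} {b : ρB.carrier}
    (h : ∀ α β, IsMax α → IsMax β → a ≤ α → b ≤ β → x ≤ tmul α β) : x ≤ tmul a b := by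
  refine le_iff_corner.2 fun c d hcd => corner_le_tmul.2 ?_
  by_contra! hn
  have h1 : ∃ α, IsMax α ∧ a ≤ α ∧ ¬ c ≤ α := by
    by_contra! h'
    exact hn.1 (ρA.isRealSpace_starMap.le_of_forall_isMax h')
  have h2 : ∃ β, IsMax β ∧ b ≤ β ∧ ¬ d ≤ β := by
    by_contra! h'
    exact hn.2 (ρB.isRealSpace_starMap.le_of_forall_isMax h')
  obtain ⟨α, hα, haα, hcα⟩ := h1
  obtain ⟨β, hβ, hbβ, hdβ⟩ := h2
  exact (corner_le_tmul.1 (hcd.trans (h α β hα hβ haα hbβ))).elim hcα hdβ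

theorem exists_le_tmul_isMax (x : MinTensor ρA ρB) :
    ∃ α β, IsMax α ∧ IsMax β ∧ x ≤ tmul α β := by
  obtain ⟨u, ⟨p, hp⟩, rfl⟩ := exists_eq_mk x
  obtain ⟨α, hα, hle⟩ := ρA.isRealSpace_starMap.exists_isMax_ge p.1
  obtain ⟨β, hβ, hle'⟩ := ρB.isRealSpace_starMap.exists_isMax_ge p.2
  exact ⟨α, β, hα, hβ, ((isGLB_mk u ⟨p, hp⟩).1 ⟨p, hp, rfl⟩).trans (tmul_le_tmul.2 ⟨hle, hle'⟩)⟩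

theorem isMax_tmul {α : ρA.carrier} {β : ρB.carrier} (hα : IsMax α) (hβ : IsMax β) :
    IsMax (tmul α β) := by
  intro y hy
  obtain ⟨α', β', -, -, hle⟩ := exists_le_tmul_isMax y
  obtain ⟨h1, h2⟩ := tmul_le_tmul.1 (hy.trans hle)
  exact hle.trans (tmul_le_tmul.2 ⟨hα h1, hβ h2⟩)

theorem le_of_forall_tmul {x y : MinTensor ρA ρB}
    (h : ∀ α β, IsMax α → IsMax β → y ≤ tmul α β → x ≤ tmul α β) : x ≤ y := by
  obtain ⟨u, hu, rfl⟩ := exists_eq_mk y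
  refine (isGLB_mk u hu).2 ?_
  rintro _ ⟨p, hp, rfl⟩
  refine le_tmul_of_forall_isMax fun α β hα hβ h1 h2 => h α β hα hβ ?_
  exact ((isGLB_mk u hu).1 ⟨p, hp, rfl⟩).trans (tmul_le_tmul.2 ⟨h1, h2⟩)

theorem generated (x : MinTensor ρA ρB) : IsGLB {p | IsMax p ∧ x ≤ p} x :=
  ⟨fun _ hp => hp.2, fun _ hy => le_of_forall_tmul fun _ _ hα hβ hle =>
    hy ⟨isMax_tmul hα hβ, hle⟩⟩

end MinTensor

end Tensor

/-! ### The star of the minimal tensor product -/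

section Tensor

variable {P Q : Type*} [PartialOrder P] [PartialOrder Q]
  {ρA : RealStructure P} {ρB : RealStructure Q}

namespace IsRealSpace

variable {A : Type*} [PartialOrder A] {s : A → A}

theorem star_le_iff (hs : IsRealSpace s) {a b : A} (ha : ¬ IsBot a) (hb : ¬ IsBot b) :
    s a ≤ b ↔ s b ≤ a := by
  constructor <;> intro h
  · simpa only [hs.star_star a ha] using hs.star_antitone _ _ (hs.star_not_bot a ha) hb h
  · simpa only [hs.star_star b hb] using hs.star_antitone _ _ (hs.star_not_bot b hb) ha h

theorem star_le_star_iff (hs : IsRealSpace s) {a b : A} (ha : ¬ IsBot a) (hb : ¬ IsBot b) :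
    s a ≤ s b ↔ b ≤ a := by
  rw [hs.star_le_iff ha (hs.star_not_bot b hb), hs.star_star b hb]

end IsRealSpace

namespace MinTensor

variable [Nontrivial ρA.carrier] [Nontrivial ρB.carrier]

local notation "⋆ᴬ" => RealStructure.starMap ρA
local notation "⋆ᴮ" => RealStructure.starMap ρB

theorem mem_starSet_iff {x y : MinTensor ρA ρB} :
    y ∈ starSet x ↔
      ∃ α β, IsMax α ∧ IsMax β ∧ x ≤ tmul α β ∧ y = corner (⋆ᴬ α) (⋆ᴮ β) := by
  constructor
  · rintro ⟨α, α', β, β', hα, hβ, hα', hβ', hle, rfl⟩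
    rw [ρA.maximal_coe_iff] at hα
    rw [ρB.maximal_coe_iff] at hβ
    refine ⟨α, β, hα, hβ, hle, ?_⟩
    congr 1
    · exact Subtype.ext (hα'.trans (ρA.coe_starMap (IsRealSpace.not_isBot_of_isMax hα)).symm)
    · exact Subtype.ext (hβ'.trans (ρB.coe_starMap (IsRealSpace.not_isBot_of_isMax hβ)).symm)
  · rintro ⟨α, β, hα, hβ, hle, rfl⟩
    exact ⟨α, _, β, _, ρA.maximal_coe_iff.2 hα, ρB.maximal_coe_iff.2 hβ,
      ρA.coe_starMap (IsRealSpace.not_isBot_of_isMax hα),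
      ρB.coe_starMap (IsRealSpace.not_isBot_of_isMax hβ), hle, rfl⟩

/-- Each corner below `x` yields an upper bound of `starSet x`; as non-bottom elements dominate a
non-bottom corner, the supremum defining the star exists. -/
theorem tmul_star_mem_upperBounds {x : MinTensor ρA ρB} {c : ρA.carrier} {d : ρB.carrier}
    (hc : ¬ IsBot c) (hd : ¬ IsBot d) (h : corner c d ≤ x) :
    tmul (⋆ᴬ c) (⋆ᴮ d) ∈ upperBounds (starSet x) := by
  intro y hy
  obtain ⟨α, β, hα, hβ, hle, rfl⟩ := mem_starSet_iff.1 hy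
  refine corner_le_tmul.2 ((corner_le_tmul.1 (h.trans hle)).imp ?_ ?_)
  · exact ρA.isRealSpace_starMap.star_antitone _ _ hc (IsRealSpace.not_isBot_of_isMax hα)
  · exact ρB.isRealSpace_starMap.star_antitone _ _ hd (IsRealSpace.not_isBot_of_isMax hβ)

theorem isLUB_star {x : MinTensor ρA ρB} (hx : ¬ IsBot x) :
    IsLUB (starSet x) (star ρA ρB x) := by
  obtain ⟨c, d, hc, hd, hle⟩ := exists_corner_le hx
  have h := isStateSpace.exists_isLUB ⟨_, tmul_star_mem_upperBounds hc hd hle⟩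
  rw [star, dif_pos h]
  exact h.choose_spec

/-- First half of the duality: tensors above the star correspond to corners below `x`. Both sides
are conditions on the pure tensors above `x`. -/
theorem star_le_tmul_iff {x : MinTensor ρA ρB} (hx : ¬ IsBot x) {c : ρA.carrier} {d : ρB.carrier}
    (hc : ¬ IsBot c) (hd : ¬ IsBot d) :
    star ρA ρB x ≤ tmul (⋆ᴬ c) (⋆ᴮ d) ↔ corner c d ≤ x := by
  constructor
  · refine fun h => le_of_forall_tmul fun α β hα hβ hle => ?_
    have := ((isLUB_star hx).1 (mem_starSet_iff.2 ⟨α, β, hα, hβ, hle, rfl⟩)).trans h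
    rw [corner_le_tmul] at this ⊢
    refine this.imp ?_ ?_
    · exact (ρA.isRealSpace_starMap.star_le_star_iff (IsRealSpace.not_isBot_of_isMax hα) hc).1
    · exact (ρB.isRealSpace_starMap.star_le_star_iff (IsRealSpace.not_isBot_of_isMax hβ) hd).1
  · exact fun h => (isLUB_star hx).2 (tmul_star_mem_upperBounds hc hd h)

/-- Second half of the duality: it extends the bounds that define the star from pure `a`, `b` to all
non-bottom ones. -/
theorem corner_star_le {x : MinTensor ρA ρB} (hx : ¬ IsBot x) {a : ρA.carrier} {b : ρB.carrier}
    (ha : ¬ IsBot a) (hb : ¬ IsBot b) (h : x ≤ tmul a b) :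
    corner (⋆ᴬ a) (⋆ᴮ b) ≤ star ρA ρB x := by
  have hA := ρA.isRealSpace_starMap
  have hB := ρB.isRealSpace_starMap
  refine le_of_forall_tmul fun α β hα hβ hle => ?_
  have hα' := IsRealSpace.not_isBot_of_isMax hα
  have hβ' := IsRealSpace.not_isBot_of_isMax hβ
  -- Writing `α` and `β` as double stars turns the bound on `star x` into a corner below `x`.
  rw [← hA.star_star α hα', ← hB.star_star β hβ',
    star_le_tmul_iff hx (hA.star_not_bot _ hα') (hB.star_not_bot _ hβ')] at hle
  rw [corner_le_tmul, hA.star_le_iff ha hα', hB.star_le_iff hb hβ']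
  exact corner_le_tmul.1 (hle.trans h)

theorem star_not_isBot {x : MinTensor ρA ρB} (hx : ¬ IsBot x) : ¬ IsBot (star ρA ρB x) := by
  obtain ⟨α, β, hα, hβ, hle⟩ := exists_le_tmul_isMax x
  have hα' := IsRealSpace.not_isBot_of_isMax hα
  have hβ' := IsRealSpace.not_isBot_of_isMax hβ
  have := corner_star_le hx hα' hβ' hle
  intro h
  rcases isBot_corner_iff.1 fun y => this.trans (h y) with h | h
  · exact ρA.isRealSpace_starMap.star_not_bot _ hα' h
  · exact ρB.isRealSpace_starMap.star_not_bot _ hβ' h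

/-- Applying both halves of the duality in succession preserves pure tensors above and corners
below; each gives one inequality. -/
theorem star_star {x : MinTensor ρA ρB} (hx : ¬ IsBot x) :
    star ρA ρB (star ρA ρB x) = x := by
  have hA := ρA.isRealSpace_starMap
  have hB := ρB.isRealSpace_starMap
  have hx' := star_not_isBot hx
  apply le_antisymm
  · refine le_of_forall_tmul fun α β hα hβ hle => ?_
    have hα' := IsRealSpace.not_isBot_of_isMax hα
    have hβ' := IsRealSpace.not_isBot_of_isMax hβ
    have := (star_le_tmul_iff hx' (hA.star_not_bot _ hα') (hB.star_not_bot _ hβ')).2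
      (corner_star_le hx hα' hβ' hle)
    rwa [hA.star_star _ hα', hB.star_star _ hβ'] at this
  · refine le_iff_corner.2 fun c d hcd => ?_
    by_cases hb : IsBot c ∨ IsBot d
    · exact isBot_corner_iff.2 hb _
    · push Not at hb
      have := corner_star_le hx' (hA.star_not_bot _ hb.1) (hB.star_not_bot _ hb.2)
        ((star_le_tmul_iff hx hb.1 hb.2).2 hcd)
      rwa [hA.star_star _ hb.1, hB.star_star _ hb.2] at this

theorem star_tmul {α : ρA.carrier} {β : ρB.carrier} (hα : IsMax α) (hβ : IsMax β) :
    star ρA ρB (tmul α β) = corner (⋆ᴬ α) (⋆ᴮ β) := by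
  have hb : ¬ IsBot (tmul α β) := fun h => by
    have := h (tmul (botL ρA) (botL ρB))
    exact IsRealSpace.not_isBot_of_isMax hα fun x =>
      (tmul_le_tmul.1 this).1.trans (ρA.isBot_bot x)
  refine (isLUB_star hb).unique ?_
  -- The only pure tensor above a pure tensor is itself.
  have : starSet (tmul α β) = {corner (⋆ᴬ α) (⋆ᴮ β)} := by
    ext y
    rw [mem_starSet_iff, mem_singleton_iff]
    constructor
    · rintro ⟨α', β', -, -, hle, rfl⟩
      obtain ⟨h1, h2⟩ := tmul_le_tmul.1 hle
      rw [hα.eq_of_le h1, hβ.eq_of_le h2]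
    · rintro rfl
      exact ⟨α, β, hα, hβ, le_rfl, rfl⟩
  rw [this]
  exact isLUB_singleton

theorem isRealSpace_star : IsRealSpace (star ρA ρB) where
  stateSpace := isStateSpace
  generated := generated
  star_not_bot _ := star_not_isBot
  star_star _ := star_star
  star_antitone x y hx hy hle := by
    refine (isLUB_star hy).2 fun z hz => (isLUB_star hx).1 ?_
    obtain ⟨α, β, hα, hβ, h, rfl⟩ := mem_starSet_iff.1 hz
    exact mem_starSet_iff.2 ⟨α, β, hα, hβ, hle.trans h, rfl⟩
  star_incompatible x hx := by
    rintro ⟨z, hz⟩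
    obtain ⟨α, β, hα, hβ, hle⟩ := exists_le_tmul_isMax z
    have hα' := IsRealSpace.not_isBot_of_isMax hα
    have hβ' := IsRealSpace.not_isBot_of_isMax hβ
    have h1 : x ≤ tmul α β := (hz (mem_insert _ _)).trans hle
    have h2 : star ρA ρB x ≤ tmul α β := (hz (mem_insert_of_mem _ rfl)).trans hle
    -- A pure tensor above both would lie above its own star, so `α` or `β` would be above its star.
    rcases corner_le_tmul.1 ((corner_star_le hx hα' hβ' h1).trans h2) with h | h
    · exact ρA.isRealSpace_starMap.not_star_le hα' le_rfl h
    · exact ρB.isRealSpace_starMap.not_star_le hβ' le_rfl h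

/-! ### The ascending chain condition for the minimal tensor product -/

/-- Every system of alternatives `c ≤ a ∨ d ≤ b`, with `(c, d) ∈ F`, is equivalent to a finite
subsystem. -/
theorem exists_finite_subsystem {C D : Type*} [PartialOrder C] [PartialOrder D] [WellFoundedGT C]
    [WellFoundedGT D] (hC : IsStateSpace C) (hD : IsStateSpace D) (F : Set (C × D)) :
    ∃ G ⊆ F, G.Finite ∧
      ∀ a b, (∀ p ∈ G, p.1 ≤ a ∨ p.2 ≤ b) → ∀ p ∈ F, p.1 ≤ a ∨ p.2 ≤ b := by
  -- Noetherian induction on a lower bound `x` for `(a, b)`. An alternative `p` not yet settled by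
  -- `x` is put into `G`; whichever side of it holds raises `x` strictly.
  have key : ∀ x : C × D, ∃ G ⊆ F, G.Finite ∧ ∀ a b, x.1 ≤ a → x.2 ≤ b →
      (∀ p ∈ G, p.1 ≤ a ∨ p.2 ≤ b) → ∀ p ∈ F, p.1 ≤ a ∨ p.2 ≤ b := by
    intro x
    induction x using WellFoundedGT.induction with
    | ind x ih =>
    by_cases h : ∀ p ∈ F, p.1 ≤ x.1 ∨ p.2 ≤ x.2
    · exact ⟨∅, empty_subset _, finite_empty, fun a b ha hb _ p hp =>
        (h p hp).imp (fun h => h.trans ha) (fun h => h.trans hb)⟩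
    · push Not at h
      obtain ⟨p, hp, h1, h2⟩ := h
      -- On this branch `x.1` is replaced by its join with `p.1`. If there is no common upper bound,
      -- no `a` qualifies and `G = ∅` will do.
      have hl : ∃ G ⊆ F, G.Finite ∧ ∀ a b, x.1 ≤ a → x.2 ≤ b → p.1 ≤ a →
          (∀ p ∈ G, p.1 ≤ a ∨ p.2 ≤ b) → ∀ p ∈ F, p.1 ≤ a ∨ p.2 ≤ b := by
        by_cases hb : BddAbove {x.1, p.1}
        · obtain ⟨t, ht⟩ := hC.exists_isLUB hb
          have hxt : x.1 ≤ t := ht.1 (mem_insert _ _)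
          have hpt : p.1 ≤ t := ht.1 (mem_insert_of_mem _ rfl)
          obtain ⟨G, hGF, hG, h⟩ := ih (t, x.2) (Prod.lt_iff.2 (Or.inl
            ⟨lt_of_le_of_ne hxt fun h => h1 (h ▸ hpt), le_rfl⟩))
          refine ⟨G, hGF, hG, fun a b ha hb hpa => h a b (ht.2 ?_) hb⟩
          rintro _ (rfl | rfl) <;> assumption
        · refine ⟨∅, empty_subset _, finite_empty, fun a b ha _ hpa => absurd ⟨a, ?_⟩ hb⟩
          rintro _ (rfl | rfl) <;> assumption
      have hr : ∃ G ⊆ F, G.Finite ∧ ∀ a b, x.1 ≤ a → x.2 ≤ b → p.2 ≤ b →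
          (∀ p ∈ G, p.1 ≤ a ∨ p.2 ≤ b) → ∀ p ∈ F, p.1 ≤ a ∨ p.2 ≤ b := by
        by_cases hb : BddAbove {x.2, p.2}
        · obtain ⟨t, ht⟩ := hD.exists_isLUB hb
          have hxt : x.2 ≤ t := ht.1 (mem_insert _ _)
          have hpt : p.2 ≤ t := ht.1 (mem_insert_of_mem _ rfl)
          obtain ⟨G, hGF, hG, h⟩ := ih (x.1, t) (Prod.lt_iff.2 (Or.inr
            ⟨le_rfl, lt_of_le_of_ne hxt fun h => h2 (h ▸ hpt)⟩))
          refine ⟨G, hGF, hG, fun a b ha hb hpb => h a b ha (ht.2 ?_)⟩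
          rintro _ (rfl | rfl) <;> assumption
        · refine ⟨∅, empty_subset _, finite_empty, fun a b _ hb' hpb => absurd ⟨b, ?_⟩ hb⟩
          rintro _ (rfl | rfl) <;> assumption
      obtain ⟨G, hGF, hG, hGp⟩ := hl
      obtain ⟨H, hHF, hH, hHp⟩ := hr
      refine ⟨insert p (G ∪ H), insert_subset hp (union_subset hGF hHF), (hG.union hH).insert p,
        fun a b ha hb hab => ?_⟩
      rcases hab p (mem_insert _ _) with h | h
      · exact hGp a b ha hb h fun q hq => hab q (mem_insert_of_mem _ (Or.inl hq))
      · exact hHp a b ha hb h fun q hq => hab q (mem_insert_of_mem _ (Or.inr hq))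
  obtain ⟨c, hc⟩ := hC.exists_bot
  obtain ⟨d, hd⟩ := hD.exists_bot
  obtain ⟨G, hGF, hG, h⟩ := key (c, d)
  exact ⟨G, hGF, hG, fun a b => h a b (hc a) (hd b)⟩

/-- The corners below some term of the chain form one system of alternatives. A finite equivalent
subsystem lies below a single term `x N`, after which the chain is constant. -/
theorem wellFoundedGT [WellFoundedGT ρA.carrier] [WellFoundedGT ρB.carrier] :
    WellFoundedGT (MinTensor ρA ρB) := by
  refine wellFoundedGT_iff_monotone_chain_condition.2 fun x => ?_
  obtain ⟨G, hGF, hG, h⟩ := exists_finite_subsystem ρA.isRealSpace_starMap.stateSpace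
    ρB.isRealSpace_starMap.stateSpace {p | ∃ n, corner p.1 p.2 ≤ x n}
  choose! f hf using fun p (hp : p ∈ G) => hGF hp
  obtain ⟨N, hN⟩ := (hG.image f).bddAbove
  refine ⟨N, fun m hm => le_antisymm (x.monotone hm) (le_of_forall_tmul fun α β _ _ hle => ?_)⟩
  refine le_iff_corner.2 fun c d hcd => corner_le_tmul.2 (h α β (fun p hp => ?_) (c, d) ⟨m, hcd⟩)
  exact corner_le_tmul.1 (((hf p hp).trans (x.monotone (hN ⟨p, hp, rfl⟩))).trans hle)

/-! ### Infima of tensors and partial traces -/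

theorem isGLB_tmul_left {S : Set ρA.carrier} {a : ρA.carrier} (b : ρB.carrier) (h : IsGLB S a) :
    IsGLB ((fun σ => tmul σ b) '' S) (tmul a b) := by
  constructor
  · rintro _ ⟨σ, hσ, rfl⟩
    exact tmul_le_tmul.2 ⟨h.1 hσ, le_rfl⟩
  · refine fun y hy => le_iff_corner.2 fun c d hcd => corner_le_tmul.2 ?_
    by_cases hd : d ≤ b
    · exact Or.inr hd
    · exact Or.inl (h.2 fun σ hσ =>
        (corner_le_tmul.1 (hcd.trans (hy ⟨σ, hσ, rfl⟩))).resolve_right hd)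

theorem isGLB_tmul_right (a : ρA.carrier) {S : Set ρB.carrier} {b : ρB.carrier} (h : IsGLB S b) :
    IsGLB ((fun τ => tmul a τ) '' S) (tmul a b) := by
  constructor
  · rintro _ ⟨τ, hτ, rfl⟩
    exact tmul_le_tmul.2 ⟨le_rfl, h.1 hτ⟩
  · refine fun y hy => le_iff_corner.2 fun c d hcd => corner_le_tmul.2 ?_
    by_cases hc : c ≤ a
    · exact Or.inl hc
    · exact Or.inr (h.2 fun τ hτ =>
        (corner_le_tmul.1 (hcd.trans (hy ⟨τ, hτ, rfl⟩))).resolve_left hc)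

/-- Describing the trace by corners shows at once that it depends only on `x`, not on a representing
family, and that it preserves infima. -/
theorem exists_traceLeft (x : MinTensor ρA ρB) :
    ∃ a, ∀ c, c ≤ a ↔ ∀ d, corner c d ≤ x := by
  obtain ⟨u, hu, rfl⟩ := exists_eq_mk x
  obtain ⟨a, ha⟩ := ρA.isRealSpace_starMap.stateSpace.exists_inf _ (hu.image Prod.fst)
  refine ⟨a, fun c => (le_isGLB_iff ha).trans ?_⟩
  simp only [corner_le_mk, mem_lowerBounds, forall_mem_image]
  exact ⟨fun h d p hp => Or.inl (h hp), fun h p hp =>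
    ρB.isRealSpace_starMap.forall_of_forall_or (ι := Unit) (f := fun _ => p.2)
      (fun d _ => h d p hp) ()⟩

theorem exists_traceRight (x : MinTensor ρA ρB) :
    ∃ b, ∀ d, d ≤ b ↔ ∀ c, corner c d ≤ x := by
  obtain ⟨u, hu, rfl⟩ := exists_eq_mk x
  obtain ⟨b, hb⟩ := ρB.isRealSpace_starMap.stateSpace.exists_inf _ (hu.image Prod.snd)
  refine ⟨b, fun d => (le_isGLB_iff hb).trans ?_⟩
  simp only [corner_le_mk, mem_lowerBounds, forall_mem_image]
  exact ⟨fun h c p hp => Or.inr (h hp), fun h p hp =>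
    ρA.isRealSpace_starMap.forall_of_forall_or (ι := Unit) (f := fun _ => p.1)
      (fun c _ => (h c p hp).symm) ()⟩

/-- The partial trace `⨅ σᵢ ⊗ τᵢ ↦ ⨅ σᵢ`. -/
noncomputable def traceLeft (x : MinTensor ρA ρB) : ρA.carrier := (exists_traceLeft x).choose

/-- The partial trace `⨅ σᵢ ⊗ τᵢ ↦ ⨅ τᵢ`. -/
noncomputable def traceRight (x : MinTensor ρA ρB) : ρB.carrier := (exists_traceRight x).choose

theorem le_traceLeft {x : MinTensor ρA ρB} {c : ρA.carrier} :
    c ≤ traceLeft x ↔ ∀ d, corner c d ≤ x := (exists_traceLeft x).choose_spec c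

theorem le_traceRight {x : MinTensor ρA ρB} {d : ρB.carrier} :
    d ≤ traceRight x ↔ ∀ c, corner c d ≤ x := (exists_traceRight x).choose_spec d

theorem preservesInf_traceLeft : PreservesInf (traceLeft (ρA := ρA) (ρB := ρB)) := by
  refine fun S x _ hx => isGLB_iff_le_iff.2 fun c => ?_
  simp only [le_traceLeft, le_isGLB_iff hx, mem_lowerBounds, forall_mem_image]
  exact ⟨fun h y hy d => h d y hy, fun h d y hy => h hy d⟩

theorem preservesInf_traceRight : PreservesInf (traceRight (ρA := ρA) (ρB := ρB)) := by
  refine fun S x _ hx => isGLB_iff_le_iff.2 fun d => ?_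
  simp only [le_traceRight, le_isGLB_iff hx, mem_lowerBounds, forall_mem_image]
  exact ⟨fun h y hy c => h c y hy, fun h c y hy => h hy c⟩

theorem traceLeft_tmul (a : ρA.carrier) (b : ρB.carrier) : traceLeft (tmul a b) = a := by
  refine eq_of_forall_le_iff fun c => le_traceLeft.trans ?_
  simp only [corner_le_tmul]
  exact ⟨fun h => ρB.isRealSpace_starMap.forall_of_forall_or (ι := Unit) (f := fun _ => b)
    (fun d _ => h d) (), fun h _ => Or.inl h⟩

theorem traceRight_tmul (a : ρA.carrier) (b : ρB.carrier) : traceRight (tmul a b) = b := by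
  refine eq_of_forall_le_iff fun d => le_traceRight.trans ?_
  simp only [corner_le_tmul]
  exact ⟨fun h => ρA.isRealSpace_starMap.forall_of_forall_or (ι := Unit) (f := fun _ => a)
    (fun c _ => (h c).symm) (), fun h _ => Or.inr h⟩

end MinTensor

end Tensor

/-! ### The bipartite requirements and the main theorem -/

namespace MinTensor

open OnticCompletion

variable {P Q : Type*} [PartialOrder P] [PartialOrder Q]
  {ρA : RealStructure P} {ρB : RealStructure Q}
  [Nontrivial ρA.carrier] [Nontrivial ρB.carrier] [WellFoundedGT (MinTensor ρA ρB)]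

theorem isGLB_principal_tmul_iff {u : Set (ρA.carrier × ρB.carrier)} (hu : u.Nonempty)
    {x : OnticCompletion (star ρA ρB)} :
    IsGLB ((fun p => principal isRealSpace_star (tmul p.1 p.2)) '' u) x ↔
      x = principal isRealSpace_star (mk u hu) := by
  have h := (isGLB_principal_image isRealSpace_star).2 (isGLB_mk u hu)
  rw [image_image] at h
  exact ⟨fun hx => hx.unique h, fun hx => hx ▸ h⟩

theorem bipartiteRequirements {ρ : RealStructure (OnticCompletion (star ρA ρB))}
    (hρ : IsOnticRealStructure ρ) :
    BipartiteRequirements ρA ρB ρ fun σ τ => principal isRealSpace_star (tmul σ τ) where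
  stateSpace := OnticCompletion.isStateSpace isRealSpace_star
  bot_eq := le_antisymm (ρ.isBot_bot _) ((isBot_principal isRealSpace_star).2
    (isBot_tmul (fun x => ρA.isBot_bot x) (fun x => ρB.isBot_bot x)) _)
  tens_mem σ τ := (hρ.mem_carrier_iff isRealSpace_star).2 ⟨_, rfl⟩
  exists_mixture := by
    intro x hx
    obtain ⟨y, rfl⟩ := (hρ.mem_carrier_iff isRealSpace_star).1 hx
    obtain ⟨u, hu, rfl⟩ := exists_eq_mk y
    exact ⟨u, hu, (isGLB_principal_tmul_iff hu).2 rfl⟩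
  tomography := by
    intro u v hu hv x _ y _ hx hy h
    rw [(isGLB_principal_tmul_iff hu).1 hx, (isGLB_principal_tmul_iff hv).1 hy]
    exact congrArg _ (Quotient.sound (s := tensorSetoid ρA ρB) h)
  bimorphic_left := by
    intro S a b hS h
    have := (isGLB_principal_image isRealSpace_star).2
      (isGLB_tmul_left b ((ρA.isGLB_coe_image_iff hS).1 h))
    rwa [image_image] at this
  bimorphic_right := by
    intro a S b hS h
    have := (isGLB_principal_image isRealSpace_star).2
      (isGLB_tmul_right a ((ρB.isGLB_coe_image_iff hS).1 h))
    rwa [image_image] at this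
  trace_left := by
    -- The traces live on `MinTensor ρA ρB` and are transported along its isomorphism with the real
    -- states of the completion.
    let e := hρ.equiv isRealSpace_star
    refine ⟨fun x => traceLeft (e.symm x), fun S a hS ha => ?_, fun u x hu hx => ?_⟩
    · have := preservesInf_traceLeft _ _ (hS.image _) (e.symm.isGLB_image'.2 ha)
      rwa [image_image] at this
    · obtain rfl : x = e (mk u hu) := Subtype.ext ((isGLB_principal_tmul_iff hu).1 hx)
      have := preservesInf_traceLeft _ _ (hu.image _) (isGLB_mk u hu)
      simpa only [image_image, traceLeft_tmul, e.symm_apply_apply] using this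
  trace_right := by
    let e := hρ.equiv isRealSpace_star
    refine ⟨fun x => traceRight (e.symm x), fun S a hS ha => ?_, fun u x hu hx => ?_⟩
    · have := preservesInf_traceRight _ _ (hS.image _) (e.symm.isGLB_image'.2 ha)
      rwa [image_image] at this
    · obtain rfl : x = e (mk u hu) := Subtype.ext ((isGLB_principal_tmul_iff hu).1 hx)
      have := preservesInf_traceRight _ _ (hu.image _) (isGLB_mk u hu)
      simpa only [image_image, traceRight_tmul, e.symm_apply_apply] using this

end MinTensor

theorem mainTheorem9 {A B : Type*} [PartialOrder A] [PartialOrder B] [Nontrivial A] [Nontrivial B]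
    [WellFoundedGT A] [WellFoundedGT B] (sA : A → A) (sB : B → B)
    (hA : IsRealSpace sA) (hB : IsRealSpace sB) :
    IsStateSpace (OnticCompletion sA) ∧ IsStateSpace (OnticCompletion sB) ∧
    ∃ (ρA : RealStructure (OnticCompletion sA)) (ρB : RealStructure (OnticCompletion sB)),
      IsOnticRealStructure ρA ∧ IsOnticRealStructure ρB ∧
      (∀ σ : MinTensor ρA ρB, ¬ IsBot σ →
        IsLUB (MinTensor.starSet σ) (MinTensor.star ρA ρB σ)) ∧
      (∀ (α α' : ρA.carrier) (β β' : ρB.carrier),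
        Maximal (· ∈ ρA.carrier) (α : OnticCompletion sA) →
        Maximal (· ∈ ρB.carrier) (β : OnticCompletion sB) →
        (α' : OnticCompletion sA) = ρA.star α → (β' : OnticCompletion sB) = ρB.star β →
        MinTensor.star ρA ρB (MinTensor.tmul α β) = MinTensor.corner α' β') ∧
      IsRealSpace (MinTensor.star ρA ρB) ∧
      FiniteRankCondition (MinTensor ρA ρB) ∧
      ∃ (ρ : RealStructure (OnticCompletion (MinTensor.star ρA ρB)))
        (tens : ρA.carrier → ρB.carrier → OnticCompletion (MinTensor.star ρA ρB)),
        IsOnticRealStructure ρ ∧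
        (∀ σ τ, (tens σ τ).toSet = {MinTensor.tmul σ τ}) ∧
        BipartiteRequirements ρA ρB ρ tens := by
  obtain ⟨ρA, hρA⟩ := OnticCompletion.exists_isOnticRealStructure hA
  obtain ⟨ρB, hρB⟩ := OnticCompletion.exists_isOnticRealStructure hB
  have : Nontrivial ρA.carrier := (hρA.equiv hA).symm.toEquiv.nontrivial
  have : Nontrivial ρB.carrier := (hρB.equiv hB).symm.toEquiv.nontrivial
  have : WellFoundedGT ρA.carrier := (hρA.equiv hA).symm.toOrderEmbedding.wellFoundedGT
  have : WellFoundedGT ρB.carrier := (hρB.equiv hB).symm.toOrderEmbedding.wellFoundedGT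
  have : WellFoundedGT (MinTensor ρA ρB) := MinTensor.wellFoundedGT
  refine ⟨OnticCompletion.isStateSpace hA, OnticCompletion.isStateSpace hB, ρA, ρB, hρA, hρB,
    fun σ => MinTensor.isLUB_star, fun α α' β β' hα hβ hα' hβ' => ?_, MinTensor.isRealSpace_star,
    MinTensor.isStateSpace.finiteRankCondition, ?_⟩
  · rw [ρA.maximal_coe_iff] at hα
    rw [ρB.maximal_coe_iff] at hβ
    obtain rfl : α' = ρA.starMap α :=
      Subtype.ext (hα'.trans (ρA.coe_starMap (IsRealSpace.not_isBot_of_isMax hα)).symm)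
    obtain rfl : β' = ρB.starMap β :=
      Subtype.ext (hβ'.trans (ρB.coe_starMap (IsRealSpace.not_isBot_of_isMax hβ)).symm)
    exact MinTensor.star_tmul hα hβ
  · obtain ⟨ρ, hρ⟩ := OnticCompletion.exists_isOnticRealStructure
      (MinTensor.isRealSpace_star (ρA := ρA) (ρB := ρB))
    exact ⟨ρ, _, hρ, fun σ τ => OnticCompletion.toSet_principal _ _,
      MinTensor.bipartiteRequirements hρ⟩
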